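/- **Setting.** Let $d\in\mathbb N$, let $\mathcal O\subset\mathbb R^d$ be a bounded domain (for example a polygonal one), $p\in(1,\infty)$, $p'=p/(p-1)$, $\kappa\ge 0$, and $S(A)=(\kappa+|A|^2)^{(p-2)/2}A$ for $A\in\mathbb R^{d\times d}$, where $|\cdot|$ is the Frobenius norm. Let $\mathbb W^{k,\infty}_{\mathrm{div}}(\mathcal O)$ be the closure, in the norm of $W^{k,\infty}(\mathcal O)^d$, of the smooth divergence-free vector fields on $\mathcal O$ with finite norm; let $g\in\mathbb W^{2,\infty}_{\mathrm{div}}(\mathcal O)$ and $\sigma\in\mathbb W^{1,\infty}_{\mathrm{div}}(\mathcal O)$. Put $\varepsilon g=\frac12(\nabla g+\nabla g^T)$ and $(\sigma\cdot\nabla)g=\sum_i\sigma_i\partial_i g$. Let $W$ be a real Wiener process on a probability space and $\tau>0$. Write $\mathbb L^2(\mathcal O)=L^2(\mathcal O;\mathbb R^d)$ and $(a,b)$ for $\int_{\mathcal O}ab\,\mathrm dx$, $\int_{\mathcal O}a\cdot b\,\mathrm dx$ or $\int_{\mathcal O}a:b\,\mathrm dx$ for scalar, vector or matrix fields. *Gradient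 discretisation.* Let $\mathcal D$ consist of finite-dimensional real vector spaces $X_{\mathcal D,0}$, $Y_{\mathcal D}$ and linear maps $\nabla_{\mathcal D},\varepsilon_{\mathcal D}:X_{\mathcal D,0}\to L^p(\mathcal O)^{d\times d}$, $\chi_{\mathcal D}:Y_{\mathcal D}\to L^{\min(p,p')}(\mathcal O)$, $\mathrm{div}_{\mathcal D}:X_{\mathcal D,0}\to L^p(\mathcal O)$, $\Pi_{\mathcal D}:X_{\mathcal D,0}\to\mathbb L^2(\mathcal O)$. With $Y_{\mathcal D,0}=\{q\in Y_{\mathcal D}:\int_{\mathcal O}\chi_{\mathcal D}q\,\mathrm dx=0\}$ and $E_{\mathcal D,0}=\{v\in X_{\mathcal D,0}:(\chi_{\mathcal D}q,\mathrm{div}_{\mathcal D}v)=0\ \forall q\in Y_{\mathcal D,0}\}$, assume that $\|\varepsilon_{\mathcal D}\cdot\|_{L^p}$ is a norm on $X_{\mathcal D,0}$, $\|\chi_{\mathcal D}\cdot\|_{L^{\min(p,p')}}$ is a norm on $Y_{\mathcal D,0}$, and $\Pi_{\mathcal D}$ is one-to-one on $E_{\mathcal D,0}$. Let $\mathcal K_{\mathcal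 D}:\mathbb L^2(\mathcal O)\to E_{\mathcal D,0}$ be defined by $(u-\Pi_{\mathcal D}\mathcal K_{\mathcal D}u,\Pi_{\mathcal D}\xi)=0$ for all $\xi\in E_{\mathcal D,0}$. Assume that $\mathcal D$ is $\Gamma$-stable for some $\Gamma\in[1,\infty)$: $\varepsilon_{\mathcal D}$ takes values in $L^{p'}(\mathcal O)^{d\times d}$ as well, and $C_{\mathcal D}(p)+C_{\mathcal D}(p')\le\Gamma$, $\beta_{\mathcal D}(p)\ge\Gamma^{-1}$, $C^{\mathrm{Sob}}_{\mathcal D}(p)+C^{\mathrm{Sob}}_{\mathcal D}(p')\le\Gamma$, where $$C_{\mathcal D}(r)=\sup_{0\ne v\in X_{\mathcal D,0}}\frac{\|\Pi_{\mathcal D}v\|_{L^r}+\|\mathrm{div}_{\mathcal D}v\|_{L^r}+\|\nabla_{\mathcal D}v\|_{L^r}}{\|\varepsilon_{\mathcal D}v\|_{L^r}},\qquad C^{\mathrm{Sob}}_{\mathcal D}(r)=\sup_{0\ne z\in \mathbb L^2(\mathcal O)\cap W^{1,r}(\mathcal O)^d}\frac{\|\varepsilon_{\mathcal D}\mathcal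 K_{\mathcal D}z\|_{L^r}}{\|z\|_{W^{1,r}}},$$ $$\beta_{\mathcal D}(p)=\inf_{0\ne q\in Y_{\mathcal D,0}}\ \sup_{v\in X_{\mathcal D,0}}\frac{(\chi_{\mathcal D}q,\mathrm{div}_{\mathcal D}v)}{\|\chi_{\mathcal D}q\|_{L^{\min(p,p')}}(\|\varepsilon_{\mathcal D}v\|_{L^p}+\|\varepsilon_{\mathcal D}v\|_{L^{p'}})}$$ (quotients $0/0$ are read as $0$). *Algorithm.* Let $B^\sigma_{\mathcal D}(v,\xi)=\frac12(\sigma^T\nabla_{\mathcal D}v,\Pi_{\mathcal D}\xi)-\frac12(\Pi_{\mathcal D}v,\sigma^T\nabla_{\mathcal D}\xi)$. Given $v^{\mathrm{in}}\in\mathbb L^2(\mathcal O)$, let $(v^0,\pi^0)\in X_{\mathcal D,0}\times Y_{\mathcal D,0}$ be the solution of $$(\Pi_{\mathcal D}v^0,\Pi_{\mathcal D}\xi)+(\chi_{\mathcal D}\pi^0,\mathrm{div}_{\mathcal D}\xi)=(v^{\mathrm{in}},\Pi_{\mathcal D}\xi),\qquad(\mathrm{div}_{\mathcal D}v^0,\chi_{\mathcal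 D}q)=0$$ for all $(\xi,q)\in X_{\mathcal D,0}\times Y_{\mathcal D,0}$, and for $n\ge0$ let $(v^{n+1},\pi^{n+1})\in X_{\mathcal D,0}\times Y_{\mathcal D,0}$ be the solution of $$(\Pi_{\mathcal D}v^{n+1}-\Pi_{\mathcal D}v^n,\Pi_{\mathcal D}\xi)+\tau\big(S(\varepsilon_{\mathcal D}v^{n+1/2}+\varepsilon g),\varepsilon_{\mathcal D}\xi\big)-(\chi_{\mathcal D}\pi^{n+1}-\chi_{\mathcal D}\pi^n,\mathrm{div}_{\mathcal D}\xi)=\big[B^\sigma_{\mathcal D}(v^{n+1/2},\xi)+((\sigma\cdot\nabla)g,\Pi_{\mathcal D}\xi)\big]\big(W((n+1)\tau)-W(n\tau)\big),$$ $$(\mathrm{div}_{\mathcal D}v^{n+1/2},\chi_{\mathcal D}q)=0$$ for all $(\xi,q)\in X_{\mathcal D,0}\times Y_{\mathcal D,0}$, where $v^{n+1/2}=\frac12(v^{n+1}+v^n)$. Write $\mathfrak S(n,v^{\mathrm{in}})=v^n$. The discrete transition semigroup is $$(\mathcal P^n_{\tau,\mathcal D}f)(v^{\mathrm{in}})=\mathbb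 E\big[f(\Pi_{\mathcal D}\mathfrak S(n,v^{\mathrm{in}}))\big],\qquad f\in C_b(\mathbb L^2(\mathcal O)).$$ A Borel probability measure $\mu$ on $\mathbb L^2(\mathcal O)$ is invariant if $\int\mathcal P^n_{\tau,\mathcal D}f\,\mathrm d\mu=\int f\,\mathrm d\mu$ for all $n\ge1$ and all $f\in C_b(\mathbb L^2(\mathcal O))$. **Theorem.** There is at most one invariant probability measure with respect to $\mathcal P_{\tau,\mathcal D}$: any two such measures coincide. -/

import Mathlib

open MeasureTheory ProbabilityTheory
open scoped NNReal ENNReal BoundedContinuousFunction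

noncomputable section

namespace StochStokes

/-! ### Vectors, matrices, Sobolev spaces -/

/-- Vectors of `ℝ^d` with the Euclidean inner product. -/
abbrev Vec (d : ℕ) := EuclideanSpace ℝ (Fin d)

/-- Real `d × d` matrices with the inner product `A : B = ∑ A i j * B i j` and the induced norm. -/
abbrev Mat (d : ℕ) := EuclideanSpace ℝ (Fin d × Fin d)

/-- The `i`-th vector of the standard basis. -/
abbrev basisVec {d : ℕ} (i : Fin d) : Vec d := EuclideanSpace.single i (1 : ℝ)

/-- `w` is the weak derivative `∂_{α 0} ⋯ ∂_{α (j-1)} u` in the open set `O`, where `α` lists the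
directions of differentiation. For `j = 0` this says that `w = u` almost everywhere in `O`. -/
structure HasWeakDeriv {d j : ℕ} (O : Set (Vec d)) (α : Fin j → Fin d) (u w : Vec d → Vec d) :
    Prop where
  locallyIntegrable : LocallyIntegrableOn u O volume
  locallyIntegrable_deriv : LocallyIntegrableOn w O volume
  integral_eq : ∀ φ : Vec d → ℝ, ContDiff ℝ (⊤ : ℕ∞) φ → HasCompactSupport φ → tsupport φ ⊆ O →
    ∫ x in O, (iteratedFDeriv ℝ j φ x fun i => basisVec (α i)) • u x
      = (-1 : ℝ) ^ j • ∫ x in O, φ x • w x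

/-- The norm of `W^{k,q}(O; ℝ^d)`, as the sum of the `L^q(O)` norms of all weak derivatives of order
at most `k`. Weak derivatives are unique almost everywhere, so the inner infimum is over one class
of functions; it is `∞` if the weak derivative does not exist. -/
def sobolevNorm {d : ℕ} (O : Set (Vec d)) (k : ℕ) (q : ℝ≥0∞) (u : Vec d → Vec d) : ℝ≥0∞ :=
  ∑ j ∈ Finset.range (k + 1), ∑ α : Fin j → Fin d,
    ⨅ (w : Vec d → Vec d) (_ : HasWeakDeriv O α u w), eLpNorm w q (volume.restrict O)

/-- Smooth solenoidal vector fields on `O`. -/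
def IsSmoothSolenoidal {d : ℕ} (O : Set (Vec d)) (u : Vec d → Vec d) : Prop :=
  ContDiffOn ℝ (⊤ : ℕ∞) u O ∧ ∀ x ∈ O, ∑ i, fderiv ℝ u x (basisVec i) i = 0

/-- Membership in the closure of the smooth solenoidal fields of finite `W^{k,q}(O)` norm with
respect to the `W^{k,q}(O)` norm. -/
def MemSobolevSolenoidal {d : ℕ} (O : Set (Vec d)) (k : ℕ) (q : ℝ≥0∞) (u : Vec d → Vec d) : Prop :=
  ∀ η : ℝ≥0∞, 0 < η → ∃ w, IsSmoothSolenoidal O w ∧ sobolevNorm O k q w < ∞ ∧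
    sobolevNorm O k q (u - w) < η

open Classical in
/-- The weak partial derivative `∂_i u` in `O` (zero if it does not exist). -/
def weakPartial {d : ℕ} (O : Set (Vec d)) (i : Fin d) (u : Vec d → Vec d) : Vec d → Vec d :=
  if h : ∃ w, HasWeakDeriv O (fun _ : Fin 1 => i) u w then h.choose else 0

/-- The symmetric gradient `ε u = (∇ u + (∇ u)ᵀ) / 2`. -/
def symGradient {d : ℕ} (O : Set (Vec d)) (u : Vec d → Vec d) (x : Vec d) : Mat d :=
  WithLp.toLp 2 fun ij => (weakPartial O ij.1 u x ij.2 + weakPartial O ij.2 u x ij.1) / 2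

/-- The transport term `(σ · ∇) u = ∑ i, σ i ∂_i u`. -/
def advect {d : ℕ} (O : Set (Vec d)) (σ u : Vec d → Vec d) (x : Vec d) : Vec d :=
  ∑ i, σ x i • weakPartial O i u x

/-- The viscous stress `S(A) = (κ + |A|²)^((p-2)/2) A` of a power-law fluid. -/
def stress {d : ℕ} (κ p : ℝ) (A : Mat d) : Mat d :=
  (κ + ‖A‖ ^ 2) ^ ((p - 2) / 2) • A

/-- The product `sᵀ A` of a row vector and a matrix. -/
def rowMul {d : ℕ} (s : Vec d) (A : Mat d) : Vec d :=
  WithLp.toLp 2 fun j => ∑ i, s i * A (i, j)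

/-- The space `L²(O; ℝ^d)`, with its Borel σ-algebra. -/
abbrev L2 {d : ℕ} (O : Set (Vec d)) := Lp (Vec d) 2 (volume.restrict O)

instance {d : ℕ} (O : Set (Vec d)) : MeasurableSpace (L2 O) := borel _

instance {d : ℕ} (O : Set (Vec d)) : BorelSpace (L2 O) := ⟨rfl⟩

/-! ### Gradient discretisations -/

/-- The spaces `X` (discrete velocities) and `Y` (discrete pressures) with the reconstructions of
gradient, symmetric gradient, pressure, divergence and velocity. -/
structure Reconstructions {d : ℕ} (O : Set (Vec d)) (p : ℝ) (X Y : Type*)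
    [AddCommGroup X] [Module ℝ X] [AddCommGroup Y] [Module ℝ Y] where
  /-- the discrete gradient `∇_D` -/
  grad : X →ₗ[ℝ] Lp (Mat d) (ENNReal.ofReal p) (volume.restrict O)
  /-- the discrete symmetric gradient `ε_D` -/
  eps : X →ₗ[ℝ] Lp (Mat d) (ENNReal.ofReal p) (volume.restrict O)
  /-- the reconstruction of the pressure `χ_D` -/
  chi : Y →ₗ[ℝ] Lp ℝ (ENNReal.ofReal (min p p.conjExponent)) (volume.restrict O)
  /-- the discrete divergence `div_D` -/
  dvg : X →ₗ[ℝ] Lp ℝ (ENNReal.ofReal p) (volume.restrict O)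
  /-- the reconstruction of the velocity `Π_D` -/
  recon : X →ₗ[ℝ] L2 O

section Basic

variable {d : ℕ} {O : Set (Vec d)} {p : ℝ} {X Y : Type*}
  [AddCommGroup X] [Module ℝ X] [AddCommGroup Y] [Module ℝ Y]

/-- The pairing `(χ_D q, div_D v)`. -/
def Reconstructions.pairing (D : Reconstructions O p X Y) (q : Y) (v : X) : ℝ :=
  ∫ x in O, D.chi q x * D.dvg v x

/-- The set `Y_{D,0}` of mean-value free discrete pressures. -/
def Reconstructions.Y0 (D : Reconstructions O p X Y) : Set Y :=
  {q | ∫ x in O, D.chi q x = 0}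

/-- The set `E_{D,0}` of discretely divergence free velocities. -/
def Reconstructions.E0 (D : Reconstructions O p X Y) : Set X :=
  {v | ∀ q ∈ D.Y0, D.pairing q v = 0}

end Basic

/-- A gradient discretisation. Seminorms composed with linear maps are seminorms, so the two norm
conditions amount to definiteness. -/
structure GradientDiscretisation {d : ℕ} (O : Set (Vec d)) (p : ℝ) (X Y : Type*)
    [AddCommGroup X] [Module ℝ X] [FiniteDimensional ℝ X]
    [AddCommGroup Y] [Module ℝ Y] [FiniteDimensional ℝ Y] extends Reconstructions O p X Y where
  eps_definite : ∀ v, eps v = 0 → v = 0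
  chi_definite : ∀ q ∈ toReconstructions.Y0, chi q = 0 → q = 0
  recon_injOn : Set.InjOn recon toReconstructions.E0

namespace GradientDiscretisation

variable {d : ℕ} {O : Set (Vec d)} {p : ℝ} {X Y : Type*}
  [AddCommGroup X] [Module ℝ X] [FiniteDimensional ℝ X]
  [AddCommGroup Y] [Module ℝ Y] [FiniteDimensional ℝ Y]

/-- The coercivity constant `C_D(r)`; in `ℝ≥0∞` the quotient at `v = 0` is `0 / 0 = 0`. -/
def coercivityConst (D : GradientDiscretisation O p X Y) (r : ℝ) : ℝ≥0∞ :=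
  ⨆ v : X, (eLpNorm (D.recon v) (ENNReal.ofReal r) (volume.restrict O)
      + eLpNorm (D.dvg v) (ENNReal.ofReal r) (volume.restrict O)
      + eLpNorm (D.grad v) (ENNReal.ofReal r) (volume.restrict O))
    / eLpNorm (D.eps v) (ENNReal.ofReal r) (volume.restrict O)

/-- The inf-sup constant `β_D(p)`. The supremum is nonnegative (replace `v` by `-v`), so truncating
the numerator at `0` does not change it. -/
def infSupConst (D : GradientDiscretisation O p X Y) : ℝ≥0∞ :=
  ⨅ (q : Y) (_ : q ∈ D.Y0) (_ : q ≠ 0), ⨆ v : X,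
    ENNReal.ofReal (D.pairing q v)
      / (eLpNorm (D.chi q) (ENNReal.ofReal (min p p.conjExponent)) (volume.restrict O)
        * (eLpNorm (D.eps v) (ENNReal.ofReal p) (volume.restrict O)
          + eLpNorm (D.eps v) (ENNReal.ofReal p.conjExponent) (volume.restrict O)))

/-- `k` is the `L²` projection of `u` onto the discretely divergence free velocities. -/
def IsProj (D : GradientDiscretisation O p X Y) (u : L2 O) (k : X) : Prop :=
  k ∈ D.E0 ∧ ∀ ξ ∈ D.E0, inner ℝ (u - D.recon k) (D.recon ξ) = 0

/-- The `L²` projection `K_D`. -/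
def proj (D : GradientDiscretisation O p X Y) (u : L2 O) : X :=
  Classical.epsilon (D.IsProj u)

/-- The Sobolev-stability constant of the `L²` projection, the supremum of
`‖ε_D K_D z‖_{L^r} / ‖z‖_{W^{1,r}}` over `z ∈ L² ∩ W^{1,r}` (if `z ∉ W^{1,r}`, the quotient
is `0`). -/
def sobolevStabilityConst (D : GradientDiscretisation O p X Y) (r : ℝ) : ℝ≥0∞ :=
  ⨆ z : L2 O, eLpNorm (D.eps (D.proj z)) (ENNReal.ofReal r) (volume.restrict O)
    / sobolevNorm O 1 (ENNReal.ofReal r) z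

/-- `Γ`-stability. The first field says that the norms `‖ε_D v‖_{L^{p'}}` in the denominators of
`C_D(p')` and `β_D(p)` are finite. -/
structure IsStable (D : GradientDiscretisation O p X Y) (Γ : ℝ≥0) : Prop where
  memLp_eps : ∀ v, MemLp (D.eps v) (ENNReal.ofReal p.conjExponent) (volume.restrict O)
  coercivity : D.coercivityConst p + D.coercivityConst p.conjExponent ≤ Γ
  infSup : (Γ : ℝ≥0∞)⁻¹ ≤ D.infSupConst
  sobolev : D.sobolevStabilityConst p + D.sobolevStabilityConst p.conjExponent ≤ Γ

/-! ### The algorithm -/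

/-- The skew-symmetric discrete noise coefficient
`B_D^σ(v, ξ) = ½ (σᵀ ∇_D v, Π_D ξ) - ½ (Π_D v, σᵀ ∇_D ξ)`. -/
def noise (D : GradientDiscretisation O p X Y) (σ : Vec d → Vec d) (v ξ : X) : ℝ :=
  (1 / 2) * (∫ x in O, inner ℝ (rowMul (σ x) (D.grad v x)) (D.recon ξ x))
    - (1 / 2) * ∫ x in O, inner ℝ (D.recon v x) (rowMul (σ x) (D.grad ξ x))

/-- `s = (v⁰, π⁰)` is the discrete Helmholtz decomposition of `u`. -/
def IsHelmholtz (D : GradientDiscretisation O p X Y) (u : L2 O) (s : X × Y) : Prop :=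
  s.2 ∈ D.Y0 ∧
  (∀ ξ : X, inner ℝ (D.recon s.1) (D.recon ξ) + D.pairing s.2 ξ = inner ℝ u (D.recon ξ)) ∧
  ∀ q ∈ D.Y0, D.pairing q s.1 = 0

/-- `s' = (v^{n+1}, π^{n+1})` is obtained from `s = (v^n, π^n)` by one step of the Crank-Nicolson
scheme with step size `τ` and Wiener increment `z`. -/
def IsStep (D : GradientDiscretisation O p X Y) (κ τ : ℝ) (g σ : Vec d → Vec d) (z : ℝ)
    (s s' : X × Y) : Prop :=
  s'.2 ∈ D.Y0 ∧
  (∀ ξ : X,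
    inner ℝ (D.recon s'.1 - D.recon s.1) (D.recon ξ)
      + τ * (∫ x in O, inner ℝ
          (stress κ p (D.eps ((1 / 2 : ℝ) • (s'.1 + s.1)) x + symGradient O g x)) (D.eps ξ x))
      - (D.pairing s'.2 ξ - D.pairing s.2 ξ)
    = (D.noise σ ((1 / 2 : ℝ) • (s'.1 + s.1)) ξ
        + ∫ x in O, inner ℝ (advect O σ g x) (D.recon ξ x)) * z) ∧
  ∀ q ∈ D.Y0, D.pairing q ((1 / 2 : ℝ) • (s'.1 + s.1)) = 0

/-- The velocities and pressures `(v^n, π^n)` generated by the algorithm from the initial velocity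
`u` and the increments `z 0, z 1, …`. The systems that define the steps are uniquely solvable for a
stable discretisation, and `Classical.epsilon` picks the solution. -/
def scheme (D : GradientDiscretisation O p X Y) (κ τ : ℝ) (g σ : Vec d → Vec d) (z : ℕ → ℝ)
    (u : L2 O) : ℕ → X × Y
  | 0 => Classical.epsilon (D.IsHelmholtz u)
  | n + 1 => Classical.epsilon (D.IsStep κ τ g σ (z n) (scheme D κ τ g σ z u n))

/-- The increments `W(t_{n+1}) - W(t_n)`, `t_n = n τ`, along the path `ω`. -/
def increments {Ω : Type*} (W : ℝ≥0 → Ω → ℝ) (τ : ℝ≥0) (ω : Ω) (n : ℕ) : ℝ :=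
  W ((n + 1 : ℕ) * τ) ω - W (n * τ) ω

/-- The solution operator: the discrete velocity `v^n` started from `u`, along the path `ω`. -/
def solution (D : GradientDiscretisation O p X Y) (κ : ℝ) (τ : ℝ≥0) (g σ : Vec d → Vec d)
    {Ω : Type*} (W : ℝ≥0 → Ω → ℝ) (n : ℕ) (u : L2 O) (ω : Ω) : X :=
  (D.scheme κ τ g σ (increments W τ ω) u n).1

/-- The discrete transition semigroup `(P^n f)(u) = 𝔼[f(Π_D v^n)]`. -/
def semigroup (D : GradientDiscretisation O p X Y) (κ : ℝ) (τ : ℝ≥0) (g σ : Vec d → Vec d)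
    {Ω : Type*} [MeasurableSpace Ω] (P : Measure Ω) (W : ℝ≥0 → Ω → ℝ)
    (n : ℕ) (f : L2 O →ᵇ ℝ) (u : L2 O) : ℝ :=
  ∫ ω, f (D.recon (D.solution κ τ g σ W n u ω)) ∂P

end GradientDiscretisation

/-- The measure `μ` on `L²(O; ℝ^d)` is invariant with respect to `(Q^n)`: for all `n ≥ 1` and
`f ∈ C_b`, `∫ Q^n f dμ = ∫ f dμ`. -/
def IsInvariant {d : ℕ} {O : Set (Vec d)} (Q : ℕ → (L2 O →ᵇ ℝ) → L2 O → ℝ) (μ : Measure (L2 O)) :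
    Prop :=
  ∀ n : ℕ, 1 ≤ n → ∀ f : L2 O →ᵇ ℝ, ∫ v, Q n f v ∂μ = ∫ v, f v ∂μ

end StochStokes

end

noncomputable section

namespace StochStokes

open Filter Topology Set

/-! ### Monotone operators on finite-dimensional spaces -/

/-! Two solutions driven by the same increments approach each other, and stationarity turns this
into equality of laws.

The pressure disappears when the equations are tested with discretely divergence free velocities.
Since `recon` is injective on these, they are identified with the finite-dimensional subspace
`velocitySpace` of `L2 O`, which carries the inner product of the scheme. There a time step has the
form `x' - x + a(w) = (b(w) + l) z` with the midpoint `w` of `x` and `x'` (`CrankNicolson`), where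
`a` is strictly monotone, because the stress is and `eps` is definite, and `b` is skew. If the
difference of two such equations is tested with the difference of the midpoints, the noise cancels:
the squared distance drops by exactly twice the monotonicity gap (`CrankNicolson.norm_sq_sub`).

For general `p` and `κ` the strict monotonicity is used without a rate, so compactness takes its
place (`tendsto_norm_sub_of_crankNicolson`). The distance decreases to some `L`. If both solutions
and the increment stay in a fixed ball infinitely often, a cluster point is a pair at distance `L`
whose distance is still `L` after one step; by strict monotonicity its two members coincide, so `L =
0`.

The recurrence comes from invariance (`eq_of_invariant_of_synchronous_coupling`). With independent
initial values of laws `μ` and `ν` and common noise, the laws at all positive times are `μ` and `ν`,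
and the increments all have one law. Hence the probability of leaving a large ball is small
uniformly in time, and almost surely the solutions return to some ball infinitely often. The two
solutions then merge almost surely, which forces `μ = ν`. -/

/-- A finite game whose payoff matrix has a nonnegative symmetric part has nonnegative value. -/
theorem exists_stdSimplex_forall_sum_nonneg {ι : Type*} [Fintype ι] [Nonempty ι] (M : ι → ι → ℝ)
    (hM : ∀ i j, 0 ≤ M i j + M j i) :
    ∃ c ∈ stdSimplex ℝ ι, ∀ i, 0 ≤ ∑ j, c j * M i j := by
  classical
  by_contra! hcon
  let T : (ι → ℝ) →ₗ[ℝ] (ι → ℝ) :=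
    { toFun := fun c i => ∑ j, c j * M i j
      map_add' := fun c c' => by ext i; simp [add_mul, Finset.sum_add_distrib]
      map_smul' := fun r c => by ext i; simp [Finset.mul_sum, mul_assoc] }
  have hT : ∀ c i, T c i = ∑ j, c j * M i j := fun _ _ => rfl
  have hTc : Continuous T := T.continuous_of_finiteDimensional
  have hconv : Convex ℝ (T '' stdSimplex ℝ ι) := (convex_stdSimplex ℝ ι).linear_image T
  have hcomp : IsCompact (T '' stdSimplex ℝ ι) := (isCompact_stdSimplex ℝ ι).image hTc
  have hpos_conv : Convex ℝ (Ici (0 : ι → ℝ)) := convex_Ici 0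
  have hdisj : Disjoint (T '' stdSimplex ℝ ι) (Ici (0 : ι → ℝ)) := by
    rw [Set.disjoint_left]
    rintro _ ⟨c, hc, rfl⟩ h0
    obtain ⟨i, hi⟩ := hcon c hc
    exact absurd (h0 i) (not_le.2 hi)
  obtain ⟨f, u, v, hfu, huv, hfv⟩ :=
    -- If no mixed strategy works, the compact convex set of payoff vectors misses the nonnegative
    -- orthant. The normalised separating functional will itself be a strategy on which the
    -- separation fails.
    geometric_hahn_banach_compact_closed hconv hcomp hpos_conv isClosed_Ici hdisj
  have hv : v < 0 := by simpa using hfv 0 (by simp)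
  set m : ι → ℝ := fun i => f (Pi.single i 1) with hm
  have hf : ∀ x, f x = ∑ i, x i * m i := fun x => by
    conv_lhs => rw [pi_eq_sum_univ' x]
    simp only [map_sum, map_smul, smul_eq_mul, hm]
  have hm0 : ∀ i, 0 ≤ m i := fun i => by
    by_contra! hi
    -- For `m i < 0` this point lies in the orthant, yet the functional takes exactly the value `v`
    -- there.
    have h := hfv ((v / m i) • Pi.single i 1) (by
      intro j
      simp only [Pi.zero_apply, Pi.smul_apply, smul_eq_mul]
      refine mul_nonneg (div_nonneg_of_nonpos hv.le hi.le) ?_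
      by_cases hj : j = i
      · subst hj; simp
      · simp [hj])
    rw [map_smul, smul_eq_mul] at h
    change v < v / m i * m i at h
    rw [div_mul_cancel₀ _ hi.ne] at h
    exact lt_irrefl _ h
  have hsum : 0 < ∑ i, m i := by
    refine lt_of_le_of_ne (Finset.sum_nonneg fun i _ => hm0 i) fun h => ?_
    have hz : ∀ i, m i = 0 := fun i =>
      (Finset.sum_eq_zero_iff_of_nonneg fun i _ => hm0 i).1 h.symm i (Finset.mem_univ i)
    obtain ⟨i⟩ := ‹Nonempty ι›
    have := hfu _ ⟨Pi.single i 1, single_mem_stdSimplex ℝ i, rfl⟩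
    rw [hf] at this
    simp only [hz, mul_zero, Finset.sum_const_zero] at this
    linarith
  have hc : (∑ i, m i)⁻¹ • m ∈ stdSimplex ℝ ι := by
    refine ⟨fun i => mul_nonneg (inv_nonneg.2 hsum.le) (hm0 i), ?_⟩
    simp only [Pi.smul_apply, smul_eq_mul, ← Finset.mul_sum]
    exact inv_mul_cancel₀ hsum.ne'
  have h1 := hfu _ ⟨_, hc, rfl⟩
  rw [map_smul, map_smul, hf] at h1
  -- A quadratic form sees only the symmetric part of its matrix.
  have h2 : 0 ≤ ∑ i, T m i * m i := by
    have e1 : ∑ i, T m i * m i = ∑ i, ∑ j, m i * m j * M i j := by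
      refine Finset.sum_congr rfl fun i _ => ?_
      rw [hT, Finset.sum_mul]
      exact Finset.sum_congr rfl fun j _ => by ring
    have e2 : ∑ i, T m i * m i = ∑ i, ∑ j, m i * m j * M j i := by
      rw [e1, Finset.sum_comm]
      exact Finset.sum_congr rfl fun i _ => Finset.sum_congr rfl fun j _ => by ring
    have e3 : 0 ≤ ∑ i, ∑ j, m i * m j * (M i j + M j i) :=
      Finset.sum_nonneg fun i _ => Finset.sum_nonneg fun j _ =>
        mul_nonneg (mul_nonneg (hm0 i) (hm0 j)) (hM i j)
    simp only [mul_add, Finset.sum_add_distrib] at e3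
    linarith
  have h3 : 0 ≤ (∑ i, m i)⁻¹ * ∑ i, T m i * m i := mul_nonneg (inv_nonneg.2 hsum.le) h2
  rw [smul_eq_mul] at h1
  linarith

section Monotone

variable {H : Type*} [NormedAddCommGroup H] [InnerProductSpace ℝ H]

/-- Monotone variational inequalities, in the weak form of Minty, are solvable on compact convex
sets. -/
theorem exists_minty_solution [FiniteDimensional ℝ H]
    {K : Set H} (hK : IsCompact K) (hconv : Convex ℝ K)
    (hne : K.Nonempty) (a : H → H →ₗ[ℝ] ℝ) (ha : ∀ x y, 0 ≤ (a x - a y) (x - y)) :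
    ∃ w ∈ K, ∀ v ∈ K, 0 ≤ a v (v - w) := by
  -- By compactness it suffices to treat finitely many `v`. A convex combination of these solves the
  -- finite system, with weights from the game `M i j = a vᵢ (vᵢ - vⱼ)`, whose symmetric part is
  -- nonnegative by monotonicity.
  have key := hK.inter_iInter_nonempty (fun v : K => {w : H | 0 ≤ a v (v - w)})
    (fun v => isClosed_le continuous_const
      ((a v).continuous_of_finiteDimensional.comp (continuous_const.sub continuous_id))) ?_
  · obtain ⟨w, hwK, hw⟩ := key
    rw [mem_iInter] at hw
    exact ⟨w, hwK, fun v hv => hw ⟨v, hv⟩⟩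
  intro s
  rcases s.eq_empty_or_nonempty with rfl | hs
  · simpa using hne
  have : Nonempty s := hs.to_subtype
  obtain ⟨c, hc, hcM⟩ := exists_stdSimplex_forall_sum_nonneg
    (fun i j : s => a (i : K) ((i : K) - (j : K) : H)) fun i j => by
      have h := ha ((i : K) : H) ((j : K) : H)
      have e : a (j : K) ((j : K) - (i : K) : H) = -(a (j : K) ((i : K) - (j : K) : H)) := by
        rw [← map_neg, neg_sub]
      rw [LinearMap.sub_apply] at h
      linarith
  refine ⟨∑ j, c j • ((j : K) : H), hconv.sum_mem (fun j _ => hc.1 j) hc.2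
    fun j _ => (j : K).2, ?_⟩
  simp only [mem_iInter, mem_ofPred_eq]
  intro v hv
  have h := hcM ⟨v, hv⟩
  have e : (v : H) - ∑ j, c j • ((j : K) : H) = ∑ j, c j • ((v : H) - ((j : K) : H)) := by
    simp only [smul_sub, Finset.sum_sub_distrib, ← Finset.sum_smul, hc.2, one_smul]
  rw [e, map_sum]
  simpa using h

/-- The theorem of Minty and Browder for strongly monotone maps in finite dimensions. -/
theorem exists_eq_zero_of_strongly_monotone [FiniteDimensional ℝ H]
    (a : H → H →ₗ[ℝ] ℝ)
    (hcont : ∀ ξ, Continuous fun w => a w ξ) {c : ℝ} (hc : 0 < c)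
    (ha : ∀ x y, c * ‖x - y‖ ^ 2 ≤ (a x - a y) (x - y)) : ∃ w, ∀ ξ, a w ξ = 0 := by
  set C := ‖(a 0).toContinuousLinearMap‖ with hC
  have hC0 : 0 ≤ C := norm_nonneg _
  have ha0 : ∀ x, -(C * ‖x‖) ≤ a 0 x := fun x => by
    have := (a 0).toContinuousLinearMap.le_opNorm x
    exact neg_le_of_abs_le this
  -- On the sphere of radius `R` this gives `a x x ≥ c R² - C R = R > 0`.
  set R := (C + 1) / c with hR
  have hR0 : 0 < R := by positivity
  have hcR : c * R = C + 1 := by rw [hR]; field_simp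
  have hpos : ∀ x, ‖x‖ = R → 0 < a x x := fun x hx => by
    have h1 := ha x 0
    have h2 := ha0 x
    simp only [sub_zero, LinearMap.sub_apply] at h1
    rw [hx] at h1 h2
    nlinarith
  obtain ⟨w, hwK, hw⟩ := exists_minty_solution (isCompact_closedBall (0 : H) R)
    (convex_closedBall 0 R) ⟨0, by simp [hR0.le]⟩ a
    fun x y => le_trans (by positivity) (ha x y)
  rw [mem_closedBall_zero_iff] at hwK
  -- Minty's trick: insert `v = w + t h`, divide by `t` and let `t` tend to `0` from the right.
  have hlim : ∀ h : H, (∀ᶠ t : ℝ in 𝓝[>] 0, ‖w + t • h‖ ≤ R) → 0 ≤ a w h := fun h hh => by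
    have hc : Tendsto (fun t : ℝ => a (w + t • h) h) (𝓝[>] 0) (𝓝 (a w h)) := by
      have : Continuous fun t : ℝ => a (w + t • h) h := (hcont h).comp (by fun_prop)
      have h2 := this.tendsto 0
      simp only [zero_smul, add_zero] at h2
      exact h2.mono_left nhdsWithin_le_nhds
    refine ge_of_tendsto hc ?_
    filter_upwards [hh, self_mem_nhdsWithin] with t ht htp
    have := hw (w + t • h) (by simpa using ht)
    rw [add_sub_cancel_left, map_smul, smul_eq_mul] at this
    exact nonneg_of_mul_nonneg_right this htp
  rcases hwK.lt_or_eq with hlt | heq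
  · have hall : ∀ h, 0 ≤ a w h := fun h => hlim h <| by
      have : Continuous fun t : ℝ => ‖w + t • h‖ := by fun_prop
      have h2 := (this.tendsto 0).eventually (Iic_mem_nhds (by simpa using hlt))
      exact nhdsWithin_le_nhds h2
    refine ⟨w, fun ξ => le_antisymm ?_ (hall ξ)⟩
    have := hall (-ξ)
    rw [map_neg] at this
    linarith
  -- A solution on the sphere could be moved inwards, along `-w`, which contradicts `0 < a w w`.
  · exfalso
    have h1 := hlim (-w) <| by
      have : ∀ᶠ t : ℝ in 𝓝[>] 0, t < 1 := nhdsWithin_le_nhds (Iio_mem_nhds one_pos)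
      filter_upwards [this, self_mem_nhdsWithin] with t ht htp
      have htp : 0 < t := htp
      have e : w + t • -w = (1 - t) • w := by rw [sub_smul, one_smul, smul_neg, sub_eq_add_neg]
      rw [e, norm_smul, Real.norm_of_nonneg (by linarith), heq]
      nlinarith
    have h2 := hpos w heq
    rw [map_neg] at h1
    linarith

/-! ### Crank-Nicolson steps -/

/-- `x'` is obtained from `x` by a Crank-Nicolson step with drift `-a`, noise coefficient `b + l`
and increment `z`. -/
def CrankNicolson (a : H → H →ₗ[ℝ] ℝ) (b : H →ₗ[ℝ] H →ₗ[ℝ] ℝ) (l : H →ₗ[ℝ] ℝ) (z : ℝ)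
    (x x' : H) : Prop :=
  ∀ ξ, inner ℝ (x' - x) ξ + a ((1 / 2 : ℝ) • (x' + x)) ξ
    = (b ((1 / 2 : ℝ) • (x' + x)) ξ + l ξ) * z

variable {a : H → H →ₗ[ℝ] ℝ} {b : H →ₗ[ℝ] H →ₗ[ℝ] ℝ} {l : H →ₗ[ℝ] ℝ}

/-- The unknown is the midpoint `w`, in terms of which `x' - x = 2 (w - x)`. The term `2 w` makes
the equation strongly monotone with constant 2 for every increment, however large, because the skew
noise does not contribute to the quadratic form. -/
theorem exists_crankNicolson [FiniteDimensional ℝ H]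
    (hcont : ∀ ξ, Continuous fun w => a w ξ)
    (hmono : ∀ x y, 0 ≤ (a x - a y) (x - y)) (hb : ∀ x, b x x = 0) (l : H →ₗ[ℝ] ℝ) (z : ℝ) (x : H) :
    ∃ x', CrankNicolson a b l z x x' := by
  let F : H → H →ₗ[ℝ] ℝ := fun w =>
    (2 : ℝ) • (innerₛₗ ℝ (w - x) : H →ₗ[ℝ] ℝ) + a w - z • (b w + l)
  have hF : ∀ w ξ, F w ξ = 2 * inner ℝ (w - x) ξ + a w ξ - z * (b w ξ + l ξ) := fun w ξ => by
    simp only [F, LinearMap.sub_apply, LinearMap.add_apply, LinearMap.smul_apply, smul_eq_mul,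
      innerₛₗ_apply_apply]
  obtain ⟨w, hw⟩ := exists_eq_zero_of_strongly_monotone F (c := 2) (fun ξ => by
      simp only [hF]
      have hbξ : Continuous fun w => b w ξ := (b.flip ξ).continuous_of_finiteDimensional
      have := hcont ξ
      fun_prop) two_pos fun v w => by
      have e : (F v - F w) (v - w)
          = 2 * ‖v - w‖ ^ 2 + (a v - a w) (v - w) - z * b (v - w) (v - w) := by
        rw [LinearMap.sub_apply, hF, hF, LinearMap.sub_apply, ← real_inner_self_eq_norm_sq, map_sub b,
          LinearMap.sub_apply]
        have : inner ℝ (v - w) (v - w) = inner ℝ (v - x) (v - w) - inner ℝ (w - x) (v - w) := by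
          rw [← inner_sub_left, sub_sub_sub_cancel_right]
        rw [this]
        ring
      rw [e, hb]
      have := hmono v w
      linarith
  refine ⟨(2 : ℝ) • w - x, fun ξ => ?_⟩
  have e1 : (1 / 2 : ℝ) • ((2 : ℝ) • w - x + x) = w := by
    rw [sub_add_cancel, smul_smul]; norm_num
  have e2 : (2 : ℝ) • w - x - x = (2 : ℝ) • (w - x) := by
    rw [smul_sub, two_smul ℝ x]; abel
  have h := hw ξ
  rw [hF] at h
  rw [e1, e2, inner_smul_left]
  simp only [conj_trivial]
  linarith

/-- Crank-Nicolson steps transported by a linear map `L` for which `R ∘ L` is an isometry. -/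
theorem crankNicolson_iff_map {V F : Type*} [AddCommGroup V] [Module ℝ V] [NormedAddCommGroup F]
    [InnerProductSpace ℝ F] (L : H →ₗ[ℝ] V) (R : V →ₗ[ℝ] F)
    (hR : ∀ x y : H, (inner ℝ (R (L x)) (R (L y)) : ℝ) = inner ℝ x y) {A B : V → V → ℝ} {f : V → ℝ}
    (ha : ∀ w ξ, a w ξ = A (L w) (L ξ)) (hb : ∀ w ξ, b w ξ = B (L w) (L ξ))
    (hl : ∀ ξ, l ξ = f (L ξ)) {z : ℝ} {x x' : H} :
    CrankNicolson a b l z x x' ↔ ∀ ξ, inner ℝ (R (L x') - R (L x)) (R (L ξ))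
      + A ((1 / 2 : ℝ) • (L x' + L x)) (L ξ)
        = (B ((1 / 2 : ℝ) • (L x' + L x)) (L ξ) + f (L ξ)) * z := by
  simp only [CrankNicolson, ha, hb, hl]
  simp only [map_smul, map_add, ← map_sub, hR]

/-- Energy identity for the difference of two solutions: the test vector is the difference of the
midpoints, against which the skew noise vanishes and the difference of the increments telescopes. -/
theorem CrankNicolson.norm_sq_sub {z : ℝ} {x x' y y' : H} (hb : ∀ x, b x x = 0)
    (hx : CrankNicolson a b l z x x') (hy : CrankNicolson a b l z y y') :
    ‖x' - y'‖ ^ 2 + 2 * (a ((1 / 2 : ℝ) • (x' + x)) - a ((1 / 2 : ℝ) • (y' + y)))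
      ((1 / 2 : ℝ) • (x' + x) - (1 / 2 : ℝ) • (y' + y)) = ‖x - y‖ ^ 2 := by
  set u := (1 / 2 : ℝ) • (x' + x) with hu
  set v := (1 / 2 : ℝ) • (y' + y) with hv
  have h1 := hx (u - v)
  have h2 := hy (u - v)
  rw [← hu] at h1
  rw [← hv] at h2
  have h3 : b u (u - v) = b v (u - v) := by
    have := hb (u - v)
    rw [map_sub b, LinearMap.sub_apply] at this
    linarith
  have h4 : inner ℝ (x' - x) (u - v) - inner ℝ (y' - y) (u - v)
      = (1 / 2) * (‖x' - y'‖ ^ 2 - ‖x - y‖ ^ 2) := by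
    have e1 : u - v = (1 / 2 : ℝ) • ((x' - y') + (x - y)) := by
      rw [hu, hv, ← smul_sub]; congr 1; abel
    rw [← inner_sub_left, e1, inner_smul_right,
      show x' - x - (y' - y) = (x' - y') - (x - y) by abel]
    generalize x' - y' = s
    generalize x - y = t
    rw [inner_add_right, inner_sub_left, inner_sub_left, real_inner_self_eq_norm_sq,
      real_inner_self_eq_norm_sq, real_inner_comm s t]
    ring
  rw [LinearMap.sub_apply]
  rw [h3] at h1
  linarith

theorem CrankNicolson.norm_sub_le {z : ℝ} {x x' y y' : H}
    (hmono : ∀ x y, 0 ≤ (a x - a y) (x - y)) (hb : ∀ x, b x x = 0)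
    (hx : CrankNicolson a b l z x x') (hy : CrankNicolson a b l z y y') :
    ‖x' - y'‖ ≤ ‖x - y‖ := by
  have h := hx.norm_sq_sub hb hy
  have h1 := hmono ((1 / 2 : ℝ) • (x' + x)) ((1 / 2 : ℝ) • (y' + y))
  exact le_of_sq_le_sq (by linarith) (norm_nonneg _)

theorem CrankNicolson.unique {z : ℝ} {x x' y' : H}
    (hmono : ∀ x y, 0 ≤ (a x - a y) (x - y)) (hb : ∀ x, b x x = 0)
    (hx : CrankNicolson a b l z x x') (hy : CrankNicolson a b l z x y') : x' = y' := by
  have h := hx.norm_sub_le hmono hb hy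
  rw [sub_self, norm_zero] at h
  exact sub_eq_zero.1 (norm_le_zero_iff.1 h)

/-- Two solutions that do not approach each other coincide. -/
theorem CrankNicolson.eq_of_norm_sub_eq {z : ℝ} {x x' y y' : H}
    (hstrict : ∀ x y, (a x - a y) (x - y) = 0 → x = y) (hb : ∀ x, b x x = 0)
    (hx : CrankNicolson a b l z x x') (hy : CrankNicolson a b l z y y')
    (hxy : ‖x' - y'‖ = ‖x - y‖) : x = y := by
  have h := hx.norm_sq_sub hb hy
  rw [hxy] at h
  -- Equal midpoints make drift and noise equal, hence also the increments `x' - x` and `y' - y`;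
  -- midpoint and increment determine the initial point.
  have hmid := hstrict _ _ (by linarith)
  have hsub : x' - x = y' - y := by
    refine ext_inner_right ℝ fun ξ => ?_
    have h1 := hx ξ
    have h2 := hy ξ
    rw [hmid] at h1
    linarith
  have hadd : x' + x = y' + y := smul_right_injective H (by norm_num : (1 / 2 : ℝ) ≠ 0) hmid
  have : (2 : ℝ) • x = (2 : ℝ) • y := by
    rw [two_smul, two_smul]
    calc x + x = (x' + x) - (x' - x) := by abel
      _ = (y' + y) - (y' - y) := by rw [hsub, hadd]
      _ = y + y := by abel
  exact smul_right_injective H (two_ne_zero : (2 : ℝ) ≠ 0) this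

/-- Stability under perturbation of both initial value and increment. By skewness `b w₁ e = b w e`,
so the noise coefficient enters only at the midpoint `w` of the reference step. The constant
therefore does not depend on the perturbed step, and continuity at the reference point follows. -/
theorem CrankNicolson.norm_mid_sub_le [FiniteDimensional ℝ H]
    {z z₁ : ℝ} {x x' x₁ x₁' : H}
    (hmono : ∀ x y, 0 ≤ (a x - a y) (x - y)) (hb : ∀ x, b x x = 0)
    (hx : CrankNicolson a b l z x x') (hx₁ : CrankNicolson a b l z₁ x₁ x₁') :
    2 * ‖(1 / 2 : ℝ) • (x₁' + x₁) - (1 / 2 : ℝ) • (x' + x)‖ ≤ 2 * ‖x₁ - x‖ +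
      ‖(b ((1 / 2 : ℝ) • (x' + x)) + l).toContinuousLinearMap‖ * |z₁ - z| := by
  set w := (1 / 2 : ℝ) • (x' + x) with hw
  set w₁ := (1 / 2 : ℝ) • (x₁' + x₁) with hw₁
  set e := w₁ - w with he
  set K := ‖(b w + l).toContinuousLinearMap‖
  have hK : |b w e + l e| ≤ K * ‖e‖ := (b w + l).toContinuousLinearMap.le_opNorm e
  have h1 := hx₁ e
  have h2 := hx e
  rw [← hw₁] at h1
  rw [← hw] at h2
  have h3 : b w₁ e = b w e := by
    have := hb e
    rw [he, map_sub b, LinearMap.sub_apply, ← he] at this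
    linarith
  have h4 : inner ℝ (x₁' - x₁) e - inner ℝ (x' - x) e = 2 * ‖e‖ ^ 2 - 2 * inner ℝ (x₁ - x) e := by
    have d1 : x₁' - x₁ = (2 : ℝ) • (w₁ - x₁) := by
      rw [hw₁, smul_sub, smul_smul, two_smul ℝ x₁]; norm_num
    have d2 : x' - x = (2 : ℝ) • (w - x) := by
      rw [hw, smul_sub, smul_smul, two_smul ℝ x]; norm_num
    rw [d1, d2, inner_smul_left, inner_smul_left, ← real_inner_self_eq_norm_sq]
    simp only [conj_trivial]
    rw [← mul_sub, ← mul_sub, ← inner_sub_left, ← inner_sub_left]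
    congr 2
    rw [he]; abel
  have h5 := hmono w₁ w
  rw [LinearMap.sub_apply, ← he] at h5
  have h6 := abs_real_inner_le_norm (x₁ - x) e
  have h7 : 2 * ‖e‖ ^ 2 = 2 * inner ℝ (x₁ - x) e - (a w₁ e - a w e)
      + (b w e + l e) * (z₁ - z) := by
    rw [h3] at h1
    linarith
  have h8 : (b w e + l e) * (z₁ - z) ≤ K * ‖e‖ * |z₁ - z| := by
    refine (le_abs_self _).trans ?_
    rw [abs_mul]
    exact mul_le_mul_of_nonneg_right hK (abs_nonneg _)
  have h9 := (le_abs_self _).trans h6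
  rcases (norm_nonneg e).eq_or_lt with h0 | h0
  · rw [← h0, mul_zero]
    exact add_nonneg (by positivity) (mul_nonneg (norm_nonneg _) (abs_nonneg _))
  · refine le_of_mul_le_mul_right ?_ h0
    nlinarith

/-- A solution operator of Crank-Nicolson steps is continuous. -/
theorem continuous_of_crankNicolson [FiniteDimensional ℝ H]
    {step : ℝ → H → H}
    (hmono : ∀ x y, 0 ≤ (a x - a y) (x - y)) (hb : ∀ x, b x x = 0)
    (hstep : ∀ z x, CrankNicolson a b l z x (step z x)) :
    Continuous fun q : ℝ × H => step q.1 q.2 := by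
  have hmid : Continuous fun q : ℝ × H => (1 / 2 : ℝ) • (step q.1 q.2 + q.2) := by
    rw [continuous_iff_continuousAt]
    rintro ⟨z, x⟩
    rw [ContinuousAt, tendsto_iff_norm_sub_tendsto_zero]
    set K := ‖(b ((1 / 2 : ℝ) • (step z x + x)) + l).toContinuousLinearMap‖
    have hlim : Tendsto (fun q : ℝ × H => ‖q.2 - x‖ + K / 2 * |q.1 - z|) (𝓝 (z, x)) (𝓝 0) := by
      have : Continuous fun q : ℝ × H => ‖q.2 - x‖ + K / 2 * |q.1 - z| := by fun_prop
      simpa using this.tendsto (z, x)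
    refine squeeze_zero (fun _ => norm_nonneg _) (fun q => ?_) hlim
    have := (hstep z x).norm_mid_sub_le hmono hb (hstep q.1 q.2)
    simp only
    linarith
  have : (fun q : ℝ × H => step q.1 q.2)
      = fun q => (2 : ℝ) • ((1 / 2 : ℝ) • (step q.1 q.2 + q.2)) - q.2 := by
    ext q
    rw [smul_smul]; norm_num
  rw [this]
  fun_prop

/-- Two sequences of Crank-Nicolson steps with the same increments approach each other, provided
that the sequences and the increments are simultaneously bounded infinitely often. -/
theorem tendsto_norm_sub_of_crankNicolson [FiniteDimensional ℝ H]
    {step : ℝ → H → H}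
    (hmono : ∀ x y, 0 ≤ (a x - a y) (x - y)) (hstrict : ∀ x y, (a x - a y) (x - y) = 0 → x = y)
    (hb : ∀ x, b x x = 0) (hstep : ∀ z x, CrankNicolson a b l z x (step z x))
    {x y : ℕ → H} {z : ℕ → ℝ} (hx : ∀ n, x (n + 1) = step (z n) (x n))
    (hy : ∀ n, y (n + 1) = step (z n) (y n)) {R : ℝ}
    (hfreq : ∃ᶠ n in atTop, ‖x n‖ ≤ R ∧ ‖y n‖ ≤ R ∧ |z n| ≤ R) :
    Tendsto (fun n => ‖x n - y n‖) atTop (𝓝 0) := by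
  have hcont := continuous_of_crankNicolson hmono hb hstep
  have hanti : Antitone fun n => ‖x n - y n‖ := antitone_nat_of_succ_le fun n => by
    rw [hx, hy]
    exact (hstep _ _).norm_sub_le hmono hb (hstep _ _)
  have hL := tendsto_atTop_ciInf hanti ⟨0, by rintro _ ⟨n, rfl⟩; exact norm_nonneg _⟩
  set L := ⨅ n, ‖x n - y n‖
  have hK : IsCompact (Metric.closedBall (0 : H) R ×ˢ Metric.closedBall (0 : H) R ×ˢ
      Metric.closedBall (0 : ℝ) R) :=
    (isCompact_closedBall _ _).prod ((isCompact_closedBall _ _).prod (isCompact_closedBall _ _))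
  -- The increments must be part of the cluster point, since the limiting pair has to make one more
  -- step.
  obtain ⟨⟨x₀, y₀, z₀⟩, -, hcl⟩ := hK.exists_mapClusterPt_of_frequently
    (f := fun n => (x n, y n, z n)) (l := atTop) (by
      refine hfreq.mono fun n hn => ?_
      simpa using hn)
  have hG1 : Continuous fun q : H × H × ℝ => ‖q.1 - q.2.1‖ := by fun_prop
  have hG2 : Continuous fun q : H × H × ℝ => ‖step q.2.2 q.1 - step q.2.2 q.2.1‖ :=
    ((hcont.comp (by fun_prop : Continuous fun q : H × H × ℝ => (q.2.2, q.1))).sub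
      (hcont.comp (by fun_prop : Continuous fun q : H × H × ℝ => (q.2.2, q.2.1)))).norm
  have huniq : ∀ G : H × H × ℝ → ℝ, Continuous G →
      Tendsto (fun n => G (x n, y n, z n)) atTop (𝓝 L) → G (x₀, y₀, z₀) = L := fun G hG ht => by
    have h1 : MapClusterPt (G (x₀, y₀, z₀)) atTop fun n => G (x n, y n, z n) :=
      hcl.continuousAt_comp hG.continuousAt
    exact eq_of_nhds_neBot ((ClusterPt.mono h1 ht).neBot)
  have e1 := huniq _ hG1 hL
  have e2 := huniq _ hG2 (by
    have := hL.comp (tendsto_add_atTop_nat 1)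
    refine this.congr fun n => ?_
    simp only [Function.comp_apply, hx, hy])
  simp only at e1 e2
  -- The limiting pair has distance `L` before and after a step with increment `z₀`, so no
  -- dissipation took place.
  have h0 := (hstep z₀ x₀).eq_of_norm_sub_eq hstrict hb (hstep z₀ y₀) (e2.trans e1.symm)
  rw [h0, sub_self, norm_zero] at e1
  rwa [← e1] at hL

end Monotone

/-! ### Invariant measures of synchronously coupled random dynamical systems -/

/-- Tightness of one finite measure, in a form that survives enlarging the radius, so that one
radius can serve several laws. -/
theorem exists_measure_norm_gt_le {E : Type*} [NormedAddCommGroup E] [SecondCountableTopology E]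
    [CompleteSpace E] [MeasurableSpace E] [BorelSpace E] (μ : Measure E) [IsFiniteMeasure μ]
    {δ : ℝ≥0∞} (hδ : 0 < δ) : ∃ R₀ : ℝ, ∀ R ≥ R₀, μ {x | R < ‖x‖} ≤ δ := by
  have h := tendsto_measure_norm_gt_of_isTightMeasureSet (isTightMeasureSet_singleton (μ := μ))
  simp only [mem_singleton_iff, iSup_iSup_eq_left] at h
  exact eventually_atTop.1 ((h.eventually (Iio_mem_nhds hδ)).mono fun _ h => le_of_lt h)

/-- The event is an increasing union of tail intersections, each contained in a single `B n`; the
maximum with 1 avoids time zero, where no bound is assumed. -/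
theorem measure_eventually_le {α : Type*} [MeasurableSpace α] (μ : Measure α) {B : ℕ → Set α}
    {δ : ℝ≥0∞} (hB : ∀ n ≥ 1, μ (B n) ≤ δ) : μ {x | ∀ᶠ n in atTop, x ∈ B n} ≤ δ := by
  have e : {x | ∀ᶠ n in atTop, x ∈ B n} = ⋃ N, ⋂ n ≥ N, B n := by
    ext x
    simp only [mem_ofPred_eq, eventually_atTop, mem_iUnion, mem_iInter]
  have hmono : Monotone fun N => ⋂ n ≥ N, B n := fun N M hNM =>
    biInter_subset_biInter_left fun n hn => le_trans hNM hn
  rw [e, hmono.measure_iUnion]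
  refine iSup_le fun N => ?_
  exact (measure_mono (biInter_subset_of_mem (le_max_left N 1))).trans (hB _ (le_max_right N 1))

/-- Consider two solutions of a random dynamical system with the same noise, and suppose that they
approach each other whenever they are, together with the noise, bounded infinitely often. Then there
is at most one invariant probability measure. -/
theorem eq_of_invariant_of_synchronous_coupling {E : Type*} [NormedAddCommGroup E]
    [SecondCountableTopology E] [CompleteSpace E] [MeasurableSpace E] [BorelSpace E]
    (Q : Measure (ℕ → ℝ)) [IsProbabilityMeasure Q] (γ : Measure ℝ) [IsProbabilityMeasure γ]
    (hQ : ∀ n, Q.map (Function.eval n) = γ)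
    (Φ : ℕ → E × (ℕ → ℝ) → E) (hΦ : ∀ n, Continuous (Φ n))
    (hmix : ∀ u v ζ R, (∃ᶠ n in atTop, ‖Φ n (u, ζ)‖ ≤ R ∧ ‖Φ n (v, ζ)‖ ≤ R ∧ |ζ n| ≤ R) →
      Tendsto (fun n => ‖Φ n (u, ζ) - Φ n (v, ζ)‖) atTop (𝓝 0))
    (μ ν : Measure E) [IsProbabilityMeasure μ] [IsProbabilityMeasure ν]
    (hμ : ∀ n ≥ 1, ∀ f : E →ᵇ ℝ, ∫ u, ∫ ζ, f (Φ n (u, ζ)) ∂Q ∂μ = ∫ u, f u ∂μ)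
    (hν : ∀ n ≥ 1, ∀ f : E →ᵇ ℝ, ∫ u, ∫ ζ, f (Φ n (u, ζ)) ∂Q ∂ν = ∫ u, f u ∂ν) :
    μ = ν := by
  have hΦm : ∀ n, Measurable (Φ n) := fun n => (hΦ n).measurable
  have hlaw : ∀ (m : Measure E) [IsProbabilityMeasure m],
      (∀ n ≥ 1, ∀ f : E →ᵇ ℝ, ∫ u, ∫ ζ, f (Φ n (u, ζ)) ∂Q ∂m = ∫ u, f u ∂m) →
      ∀ n ≥ 1, (m.prod Q).map (Φ n) = m := fun m _ hm n hn => by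
    have := Measure.isProbabilityMeasure_map (μ := m.prod Q) (hΦm n).aemeasurable
    refine ext_of_forall_integral_eq_of_IsFiniteMeasure fun f => ?_
    rw [integral_map (hΦm n).aemeasurable f.continuous.aestronglyMeasurable, ← hm n hn f,
      integral_prod]
    refine Integrable.of_bound ((f.continuous.comp (hΦ n)).aestronglyMeasurable) ‖f‖ ?_
    exact Eventually.of_forall fun x => f.norm_coe_le_norm _
  -- Independent initial values, but the same noise for both solutions.
  set ρ := (μ.prod ν).prod Q
  let X : ℕ → (E × E) × (ℕ → ℝ) → E := fun n q => Φ n (q.1.1, q.2)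
  let Y : ℕ → (E × E) × (ℕ → ℝ) → E := fun n q => Φ n (q.1.2, q.2)
  have hXm : ∀ n, Measurable (X n) := fun n => (hΦm n).comp (by fun_prop)
  have hYm : ∀ n, Measurable (Y n) := fun n => (hΦm n).comp (by fun_prop)
  have hX : ∀ n ≥ 1, ρ.map (X n) = μ := fun n hn => by
    have h1 : MeasurePreserving (Prod.map Prod.fst id : (E × E) × (ℕ → ℝ) → E × (ℕ → ℝ))
      ρ (μ.prod Q) := measurePreserving_fst.prod (MeasurePreserving.id Q)
    rw [← hlaw μ hμ n hn, ← h1.map_eq, Measure.map_map (hΦm n) h1.measurable]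
    rfl
  have hY : ∀ n ≥ 1, ρ.map (Y n) = ν := fun n hn => by
    have h1 : MeasurePreserving (Prod.map Prod.snd id : (E × E) × (ℕ → ℝ) → E × (ℕ → ℝ))
      ρ (ν.prod Q) := measurePreserving_snd.prod (MeasurePreserving.id Q)
    rw [← hlaw ν hν n hn, ← h1.map_eq, Measure.map_map (hΦm n) h1.measurable]
    rfl
  have hZm : ∀ n, Measurable fun q : (E × E) × (ℕ → ℝ) => q.2 n := fun n => by fun_prop
  have hZ : ∀ n, ρ.map (fun q => q.2 n) = γ := fun n => by
    have h1 : MeasurePreserving (Prod.snd : (E × E) × (ℕ → ℝ) → _) ρ Q := measurePreserving_snd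
    rw [← hQ n, ← h1.map_eq, Measure.map_map (measurable_pi_apply n) h1.measurable]
    rfl
  have hae : ∀ᵐ q ∂ρ, Tendsto (fun n => ‖X n q - Y n q‖) atTop (𝓝 0) := by
    rw [ae_iff]
    refine le_antisymm (ENNReal.le_of_forall_pos_le_add fun ε hε _ => ?_) zero_le
    rw [zero_add]
    set δ : ℝ≥0∞ := (ε : ℝ≥0∞) / 3 with hδ
    have hδ0 : 0 < δ := ENNReal.div_pos (by exact_mod_cast hε.ne') (by simp)
    obtain ⟨R₁, hR₁⟩ := exists_measure_norm_gt_le μ hδ0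
    obtain ⟨R₂, hR₂⟩ := exists_measure_norm_gt_le ν hδ0
    obtain ⟨R₃, hR₃⟩ := exists_measure_norm_gt_le γ hδ0
    set R := max R₁ (max R₂ R₃)
    let B : ℕ → Set ((E × E) × (ℕ → ℝ)) := fun n =>
      (X n ⁻¹' {x | R < ‖x‖} ∪ Y n ⁻¹' {x | R < ‖x‖}) ∪ (fun q => q.2 n) ⁻¹' {x | R < ‖x‖}
    have hBn : ∀ n ≥ 1, ρ (B n) ≤ ε := fun n hn => by
      have b1 : ρ (X n ⁻¹' {x | R < ‖x‖}) ≤ δ := by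
        rw [← Measure.map_apply (hXm n) (isOpen_lt continuous_const continuous_norm).measurableSet,
          hX n hn]
        exact hR₁ R (le_max_left _ _)
      have b2 : ρ (Y n ⁻¹' {x | R < ‖x‖}) ≤ δ := by
        rw [← Measure.map_apply (hYm n) (isOpen_lt continuous_const continuous_norm).measurableSet,
          hY n hn]
        exact hR₂ R ((le_max_left _ _).trans (le_max_right _ _))
      have b3 : ρ ((fun q => q.2 n) ⁻¹' {x | R < ‖x‖}) ≤ δ := by
        rw [← Measure.map_apply (hZm n) (isOpen_lt continuous_const continuous_norm).measurableSet,
          hZ n]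
        exact hR₃ R ((le_max_right _ _).trans (le_max_right _ _))
      calc ρ (B n) ≤ δ + δ + δ := (measure_union_le _ _).trans
            (add_le_add ((measure_union_le _ _).trans (add_le_add b1 b2)) b3)
        _ = ε := ENNReal.add_thirds _
    -- If the distance does not tend to zero, the recurrence assumed in `hmix` fails, so from some
    -- time on one of the three quantities exceeds `R`.
    refine (measure_mono fun q hq => ?_).trans (measure_eventually_le ρ hBn)
    by_contra hcon
    refine hq (hmix q.1.1 q.1.2 q.2 R ?_)
    simp only [mem_ofPred_eq, not_eventually] at hcon
    refine hcon.mono fun n hn => ?_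
    simpa [B, X, Y, not_or, and_assoc] using hn
  -- The shift by one skips time zero: invariance concerns `n ≥ 1` only, and `Φ 0` need not preserve
  -- `μ` and `ν`.
  have hmeas : TendstoInMeasure ρ (fun n q => X (n + 1) q - Y (n + 1) q) atTop 0 := by
    refine tendstoInMeasure_of_tendsto_ae
      (fun n => ((hXm _).sub (hYm _)).aestronglyMeasurable) (hae.mono fun q hq => ?_)
    exact tendsto_zero_iff_norm_tendsto_zero.2 (hq.comp (tendsto_add_atTop_nat 1))
  have hYd : TendstoInDistribution (fun n => Y (n + 1)) atTop (Y 1) (fun _ => ρ) ρ :=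
    tendstoInDistribution_of_identDistrib 0
      (fun j => ⟨(hYm _).aemeasurable, (hYm _).aemeasurable, by
        rw [hY _ (by simp), hY _ (by simp)]⟩)
      ⟨(hYm _).aemeasurable, (hYm _).aemeasurable, rfl⟩
  have hXd : TendstoInDistribution (fun n => X (n + 1)) atTop (X 1) (fun _ => ρ) ρ :=
    tendstoInDistribution_of_identDistrib 0
      (fun j => ⟨(hXm _).aemeasurable, (hXm _).aemeasurable, by
        rw [hX _ (by simp), hX _ (by simp)]⟩)
      ⟨(hXm _).aemeasurable, (hXm _).aemeasurable, rfl⟩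
  -- `Y (n + 1)` has the constant law `ν`, so by Slutsky `X (n + 1)` converges to `ν` in
  -- distribution; its own law is constantly `μ`.
  have hXd' := tendstoInDistribution_of_tendstoInMeasure_sub (fun n => X (n + 1)) (Y 1) hYd hmeas
    fun n => (hXm _).aemeasurable
  rw [← hX 1 le_rfl, ← hY 1 le_rfl]
  exact tendstoInDistribution_unique _ hXd hXd'

/-! ### The stress tensor -/

section Stress

variable {d : ℕ} {κ p : ℝ}

theorem norm_stress (hκ : 0 ≤ κ) (A : Mat d) :
    ‖stress κ p A‖ = (κ + ‖A‖ ^ 2) ^ ((p - 2) / 2) * ‖A‖ := by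
  rw [stress, norm_smul, Real.norm_of_nonneg (Real.rpow_nonneg (by positivity) _)]

theorem norm_stress_le (hκ : 0 ≤ κ) (A : Mat d) :
    ‖stress κ p A‖ ≤ (κ + ‖A‖ ^ 2) ^ ((p - 1) / 2) := by
  rw [norm_stress hκ]
  rcases (norm_nonneg A).eq_or_lt with h | h
  · rw [← h, mul_zero]
    exact Real.rpow_nonneg (by positivity) _
  · have hpos : 0 < κ + ‖A‖ ^ 2 := by positivity
    have h1 : ‖A‖ ≤ (κ + ‖A‖ ^ 2) ^ (1 / 2 : ℝ) := by
      rw [← Real.sqrt_eq_rpow]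
      exact Real.le_sqrt_of_sq_le (by linarith)
    calc (κ + ‖A‖ ^ 2) ^ ((p - 2) / 2) * ‖A‖
        ≤ (κ + ‖A‖ ^ 2) ^ ((p - 2) / 2) * (κ + ‖A‖ ^ 2) ^ (1 / 2 : ℝ) :=
          mul_le_mul_of_nonneg_left h1 (Real.rpow_nonneg hpos.le _)
      _ = (κ + ‖A‖ ^ 2) ^ ((p - 1) / 2) := by
          rw [← Real.rpow_add hpos]; congr 1; ring

/-- The common bound `M` for both arguments yields a majorant that is integrable as soon as `M` is
in `L^p`; it serves integrability and dominated convergence alike. -/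
theorem abs_inner_stress_le (hκ : 0 ≤ κ) (hp : 1 < p) {A B : Mat d} {M : ℝ} (hA : ‖A‖ ≤ M)
    (hB : ‖B‖ ≤ M) : |inner ℝ (stress κ p A) B| ≤ (√κ + M) ^ p := by
  have hM : 0 ≤ M := (norm_nonneg A).trans hA
  have hs : κ + ‖A‖ ^ 2 ≤ (√κ + M) ^ 2 := by
    have := Real.sq_sqrt hκ
    have := Real.sqrt_nonneg κ
    nlinarith [norm_nonneg A]
  have h1 : ‖stress κ p A‖ ≤ (√κ + M) ^ (p - 1) := by
    refine (norm_stress_le hκ A).trans ?_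
    refine (Real.rpow_le_rpow (by positivity) hs (by linarith)).trans_eq ?_
    rw [← Real.rpow_natCast, ← Real.rpow_mul (by positivity)]
    congr 1
    push_cast
    ring
  have h2 : ‖B‖ ≤ √κ + M := hB.trans (by linarith [Real.sqrt_nonneg κ])
  refine (abs_real_inner_le_norm _ _).trans ?_
  refine (mul_le_mul h1 h2 (norm_nonneg _) (by positivity)).trans_eq ?_
  rcases (add_nonneg (Real.sqrt_nonneg κ) hM).eq_or_lt with h | h
  · rw [← h, mul_zero, Real.zero_rpow (by linarith)]
  · conv_lhs => rw [← Real.rpow_one (√κ + M), ← Real.rpow_mul h.le, one_mul, ← Real.rpow_add h]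
    congr 1
    ring

theorem continuous_stress (hκ : 0 ≤ κ) (hp : 1 < p) :
    Continuous (stress κ p : Mat d → Mat d) := by
  rw [continuous_iff_continuousAt]
  intro A
  by_cases h : κ + ‖A‖ ^ 2 = 0
  · have hA : A = 0 := by
      have : ‖A‖ ^ 2 = 0 := by nlinarith [sq_nonneg ‖A‖]
      simpa using this
    have hκ0 : κ = 0 := by simpa [hA] using h
    subst hA
    have h0 : stress κ p (0 : Mat d) = 0 := smul_zero _
    -- In the degenerate case `κ = 0`, `A = 0` the factor may be singular, but the growth bound has
    -- the positive exponent `(p - 1) / 2`.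
    rw [ContinuousAt, h0]
    refine squeeze_zero_norm (fun B => norm_stress_le hκ B) ?_
    have hc : Continuous fun B : Mat d => (κ + ‖B‖ ^ 2) ^ ((p - 1) / 2) :=
      Continuous.rpow_const (by fun_prop) fun _ => Or.inr (by linarith)
    have h1 := hc.tendsto 0
    simpa [hκ0, Real.zero_rpow (by linarith : (p - 1) / 2 ≠ 0)] using h1
  · have h1 : ContinuousAt (fun B : Mat d => (κ + ‖B‖ ^ 2) ^ ((p - 2) / 2)) A :=
      ContinuousAt.rpow_const (by fun_prop) (Or.inl h)
    exact h1.smul continuousAt_id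

theorem strictMonoOn_stress_modulus (hκ : 0 ≤ κ) (hp : 1 < p) :
    StrictMonoOn (fun r : ℝ => (κ + r ^ 2) ^ ((p - 2) / 2) * r) (Ici 0) := by
  intro s hs r hr hsr
  have hs : 0 ≤ s := hs
  have hr0 : 0 < r := hs.trans_lt hsr
  have hrpos : 0 < κ + r ^ 2 := by positivity
  simp only
  rcases hs.eq_or_lt with h | h
  · rw [← h, mul_zero]
    exact mul_pos (Real.rpow_pos_of_pos hrpos _) hr0
  have hspos : 0 < κ + s ^ 2 := by positivity
  -- For `p < 2` the first factor decreases. Moving a square root over leaves a strictly increasing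
  -- power, with exponent `(p - 1) / 2`, times the nondecreasing `t / √(κ + t²)`.
  have split : ∀ t : ℝ, 0 < κ + t ^ 2 → (κ + t ^ 2) ^ ((p - 2) / 2) * t
      = (κ + t ^ 2) ^ ((p - 1) / 2) * (t / √(κ + t ^ 2)) := fun t ht => by
    rw [Real.sqrt_eq_rpow, div_eq_mul_inv t, ← Real.rpow_neg ht.le, mul_comm t, ← mul_assoc,
      ← Real.rpow_add ht]
    congr 2
    ring
  rw [split s hspos, split r hrpos]
  refine mul_lt_mul (Real.rpow_lt_rpow hspos.le (by nlinarith) (by linarith)) ?_ (by positivity)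
    (by positivity)
  rw [div_le_div_iff₀ (by positivity) (by positivity)]
  refine le_of_sq_le_sq ?_ (by positivity)
  rw [mul_pow, mul_pow, Real.sq_sqrt hspos.le, Real.sq_sqrt hrpos.le]
  nlinarith [mul_nonneg hκ (by nlinarith : 0 ≤ r ^ 2 - s ^ 2)]

/-- If the norms differ, Cauchy-Schwarz reduces the claim to strict monotonicity of the modulus; if
they agree, the expression is a positive multiple of `‖A - B‖²`. -/
theorem inner_stress_sub_pos (hκ : 0 ≤ κ) (hp : 1 < p) {A B : Mat d} (hAB : A ≠ B) :
    0 < inner ℝ (stress κ p A - stress κ p B) (A - B) := by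
  set f : ℝ → ℝ := fun r => (κ + r ^ 2) ^ ((p - 2) / 2) with hf
  have hmono := strictMonoOn_stress_modulus hκ hp
  have hf0 : ∀ r, 0 ≤ f r := fun r => Real.rpow_nonneg (by positivity) _
  have hcs := real_inner_le_norm A B
  have e : inner ℝ (stress κ p A - stress κ p B) (A - B)
      = f ‖A‖ * ‖A‖ ^ 2 + f ‖B‖ * ‖B‖ ^ 2 - (f ‖A‖ + f ‖B‖) * inner ℝ A B := by
    simp only [stress, inner_sub_left, inner_sub_right, inner_smul_left, conj_trivial,
      real_inner_self_eq_norm_sq, real_inner_comm A B, hf]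
    ring
  rw [e]
  by_cases hn : ‖A‖ = ‖B‖
  · rw [hn]
    have hB : 0 < ‖B‖ := by
      rw [norm_pos_iff]
      rintro rfl
      rw [norm_zero, norm_eq_zero] at hn
      exact hAB hn
    have h1 : 0 < f ‖B‖ := Real.rpow_pos_of_pos (by positivity) _
    have h2 : 0 < ‖A - B‖ ^ 2 := by
      have := norm_pos_iff.2 (sub_ne_zero.2 hAB)
      positivity
    rw [norm_sub_sq_real, hn] at h2
    nlinarith
  · have h1 : 0 < (f ‖A‖ * ‖A‖ - f ‖B‖ * ‖B‖) * (‖A‖ - ‖B‖) := by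
      rcases lt_or_gt_of_ne hn with h | h
      · exact mul_pos_of_neg_of_neg
          (sub_neg.2 (hmono (norm_nonneg A) (norm_nonneg B) h)) (sub_neg.2 h)
      · exact mul_pos (sub_pos.2 (hmono (norm_nonneg B) (norm_nonneg A) h)) (sub_pos.2 h)
    have h2 : (f ‖A‖ + f ‖B‖) * inner ℝ A B ≤ (f ‖A‖ + f ‖B‖) * (‖A‖ * ‖B‖) :=
      mul_le_mul_of_nonneg_left hcs (add_nonneg (hf0 _) (hf0 _))
    nlinarith

theorem inner_stress_sub_nonneg (hκ : 0 ≤ κ) (hp : 1 < p) (A B : Mat d) :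
    0 ≤ inner ℝ (stress κ p A - stress κ p B) (A - B) := by
  by_cases h : A = B
  · simp [h]
  · exact (inner_stress_sub_pos hκ hp h).le

end Stress

/-! ### Weak derivatives -/

section WeakDeriv

variable {d j : ℕ} {O : Set (Vec d)} {α : Fin j → Fin d} {u u' w w' : Vec d → Vec d}

theorem integrable_smul_of_locallyIntegrableOn {ψ : Vec d → ℝ} (hψ : Continuous ψ)
    {K : Set (Vec d)} (hK : IsCompact K) (hKO : K ⊆ O) (hψK : Function.support ψ ⊆ K)
    (hu : LocallyIntegrableOn u O volume) : Integrable (fun x => ψ x • u x) := by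
  have h1 := (hu.integrableOn_compact_subset hKO hK).continuousOn_smul hψ.continuousOn hK
  refine h1.integrable_of_forall_notMem_eq_zero fun x hx => ?_
  have : ψ x = 0 := by
    by_contra h
    exact hx (hψK h)
  simp [this]

theorem HasWeakDeriv.add (h : HasWeakDeriv O α u w) (h' : HasWeakDeriv O α u' w') :
    HasWeakDeriv O α (u + u') (w + w') where
  locallyIntegrable := h.1.add h'.1
  locallyIntegrable_deriv := h.2.add h'.2
  integral_eq φ hφ hc hs := by
    have hder : Continuous fun x => iteratedFDeriv ℝ j φ x fun i => basisVec (α i) := by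
      have := hφ.continuous_iteratedFDeriv (m := j) (by exact_mod_cast le_top)
      exact (ContinuousMultilinearMap.apply ℝ (fun _ : Fin j => Vec d) ℝ
        fun i => basisVec (α i)).continuous.comp this
    have hsupp : Function.support (fun x => iteratedFDeriv ℝ j φ x fun i => basisVec (α i))
        ⊆ tsupport φ := fun x hx => support_iteratedFDeriv_subset (𝕜 := ℝ) j fun h0 => hx (by simp [h0])
    have i1 := fun {v} (hv : LocallyIntegrableOn v O volume) =>
      (integrable_smul_of_locallyIntegrableOn hder hc hs hsupp hv).integrableOn (s := O)
    have i2 := fun {v} (hv : LocallyIntegrableOn v O volume) =>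
      (integrable_smul_of_locallyIntegrableOn hφ.continuous hc hs subset_closure hv).integrableOn
        (s := O)
    simp only [Pi.add_apply, smul_add]
    rw [integral_add (i1 h.1) (i1 h'.1), integral_add (i2 h.2) (i2 h'.2), smul_add,
      h.3 φ hφ hc hs, h'.3 φ hφ hc hs]

/-- The fundamental lemma of the calculus of variations. It transfers integrability from the
derivative supplied by a finite Sobolev norm to the one chosen in `weakPartial`. -/
theorem HasWeakDeriv.ae_eq (hO : IsOpen O) (h : HasWeakDeriv O α u w) (h' : HasWeakDeriv O α u w') :
    w =ᵐ[volume.restrict O] w' := by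
  have key := hO.ae_eq_zero_of_integral_contDiff_smul_eq_zero (μ := volume) (h.2.sub h'.2)
    fun φ hφ hc hs => by
      have i2 := fun {v} (hv : LocallyIntegrableOn v O volume) =>
        integrable_smul_of_locallyIntegrableOn hφ.continuous hc hs subset_closure hv
      have h0 : ∀ v : Vec d → Vec d, ∀ x ∉ O, φ x • v x = 0 := fun v x hx => by
        rw [image_eq_zero_of_notMem_tsupport fun hx' => hx (hs hx'), zero_smul]
      have e := (h.3 φ hφ hc hs).symm.trans (h'.3 φ hφ hc hs)
      rw [setIntegral_eq_integral_of_forall_compl_eq_zero (h0 w),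
        setIntegral_eq_integral_of_forall_compl_eq_zero (h0 w')] at e
      simp only [Pi.sub_apply, smul_sub]
      rw [integral_sub (i2 h.2) (i2 h'.2), sub_eq_zero]
      exact smul_right_injective _ (pow_ne_zero j (by norm_num : (-1 : ℝ) ≠ 0)) e
  rw [EventuallyEq, ae_restrict_iff' hO.measurableSet]
  exact key.mono fun x hx hxO => sub_eq_zero.1 (hx hxO)

theorem hasWeakDeriv_zero (hu : LocallyIntegrableOn u O volume) (α : Fin 0 → Fin d) :
    HasWeakDeriv O α u u where
  locallyIntegrable := hu
  locallyIntegrable_deriv := hu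
  integral_eq φ _ _ _ := by simp

theorem exists_hasWeakDeriv_of_sobolevNorm_lt_top {k : ℕ} {q : ℝ≥0∞} (hjk : j ≤ k)
    (h : sobolevNorm O k q u < ∞) (α : Fin j → Fin d) :
    ∃ w, HasWeakDeriv O α u w ∧ MemLp w q (volume.restrict O) := by
  have h1 := ENNReal.sum_lt_top.1 h j (Finset.mem_range.2 (Nat.lt_succ_of_le hjk))
  have h2 := ENNReal.sum_lt_top.1 h1 α (Finset.mem_univ α)
  simp only [iInf_lt_iff] at h2
  obtain ⟨w, hw, hlt⟩ := h2
  exact ⟨w, hw, hw.locallyIntegrable_deriv.aestronglyMeasurable, hlt⟩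

/-- A single approximant `v` at finite distance suffices: `u = (u - v) + v`, and both summands have
finite Sobolev norm. -/
theorem MemSobolevSolenoidal.exists_hasWeakDeriv {k : ℕ} {q : ℝ≥0∞} (hjk : j ≤ k)
    (h : MemSobolevSolenoidal O k q u) (α : Fin j → Fin d) :
    ∃ w, HasWeakDeriv O α u w ∧ MemLp w q (volume.restrict O) := by
  obtain ⟨v, -, hv, huv⟩ := h 1 one_pos
  obtain ⟨w₁, h₁, m₁⟩ := exists_hasWeakDeriv_of_sobolevNorm_lt_top hjk hv α
  obtain ⟨w₂, h₂, m₂⟩ :=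
    exists_hasWeakDeriv_of_sobolevNorm_lt_top hjk (huv.trans ENNReal.one_lt_top) α
  refine ⟨w₂ + w₁, ?_, m₂.add m₁⟩
  simpa using h₂.add h₁

theorem MemSobolevSolenoidal.memLp {k : ℕ} {q : ℝ≥0∞} (hO : IsOpen O)
    (h : MemSobolevSolenoidal O k q u) : MemLp u q (volume.restrict O) := by
  obtain ⟨w, hw, hm⟩ := h.exists_hasWeakDeriv (Nat.zero_le k) Fin.elim0
  exact hm.ae_eq (hw.ae_eq hO (hasWeakDeriv_zero hw.1 _))

theorem MemSobolevSolenoidal.memLp_weakPartial {k : ℕ} {q : ℝ≥0∞} (hO : IsOpen O) (hk : 1 ≤ k)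
    (h : MemSobolevSolenoidal O k q u) (i : Fin d) :
    MemLp (weakPartial O i u) q (volume.restrict O) := by
  obtain ⟨w, hw, hm⟩ := h.exists_hasWeakDeriv hk fun _ : Fin 1 => i
  have hex : ∃ w, HasWeakDeriv O (fun _ : Fin 1 => i) u w := ⟨w, hw⟩
  rw [weakPartial, dif_pos hex]
  exact hm.ae_eq (hw.ae_eq hO hex.choose_spec)

theorem MemSobolevSolenoidal.memLp_symGradient {k : ℕ} {q : ℝ≥0∞} (hO : IsOpen O) (hk : 1 ≤ k)
    (h : MemSobolevSolenoidal O k q u) : MemLp (symGradient O u) q (volume.restrict O) := by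
  refine MemLp.of_eval_piLp fun ij => ?_
  have h1 := (((h.memLp_weakPartial hO hk ij.1).eval_piLp ij.2).add
    ((h.memLp_weakPartial hO hk ij.2).eval_piLp ij.1)).const_mul (1 / 2)
  refine h1.ae_eq (Eventually.of_forall fun x => ?_)
  simp only [symGradient, Pi.add_apply]
  ring

theorem memLp_advect {σ : Vec d → Vec d} (hσ : MemLp σ ∞ (volume.restrict O)) {k : ℕ} {q : ℝ≥0∞}
    (hO : IsOpen O) (hk : 1 ≤ k) (h : MemSobolevSolenoidal O k q u) :
    MemLp (advect O σ u) q (volume.restrict O) := by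
  have := memLp_finsetSum Finset.univ fun i _ =>
    (h.memLp_weakPartial hO hk i).smul (r := q) (hσ.eval_piLp i)
  exact this.ae_eq (Eventually.of_forall fun x => by simp [advect])

theorem memLp_rowMul {σ : Vec d → Vec d} (hσ : MemLp σ ∞ (volume.restrict O)) {q : ℝ≥0∞}
    {A : Vec d → Mat d} (hA : MemLp A q (volume.restrict O)) :
    MemLp (fun x => rowMul (σ x) (A x)) q (volume.restrict O) := by
  refine MemLp.of_eval_piLp fun j => ?_
  have := memLp_finsetSum Finset.univ fun i _ =>
    (hA.eval_piLp (i, j)).smul (r := q) (hσ.eval_piLp i)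
  exact this.ae_eq (Eventually.of_forall fun x => by simp [rowMul])

end WeakDeriv

theorem integrable_inner_of_memLp {α E : Type*} [MeasurableSpace α] {μ : Measure α}
    [NormedAddCommGroup E] [InnerProductSpace ℝ E] {f g : α → E} {p q : ℝ≥0∞}
    [p.HolderTriple q 1] (hf : MemLp f p μ) (hg : MemLp g q μ) :
    Integrable (fun x => (inner ℝ (f x) (g x) : ℝ)) μ := by
  refine (hf.norm.integrable_mul hg.norm).mono' (hf.1.inner hg.1) (Eventually.of_forall fun x => ?_)
  exact norm_inner_le_norm _ _

/-! ### The stress functional -/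

section StressIntegral

variable {α : Type*} [MeasurableSpace α] {m : Measure α} {d : ℕ} {κ p : ℝ}

theorem coeFn_lp_sum {E ι : Type*} [NormedAddCommGroup E] {q : ℝ≥0∞} (s : Finset ι)
    (f : ι → Lp E q m) : (∑ i ∈ s, f i : Lp E q m) =ᵐ[m] fun x => ∑ i ∈ s, f i x := by
  classical
  induction s using Finset.induction_on with
  | empty =>
    simp only [Finset.sum_empty]
    exact Lp.coeFn_zero E q m
  | insert i s hi ih =>
    rw [Finset.sum_insert hi]
    filter_upwards [Lp.coeFn_add (f i) (∑ i ∈ s, f i), ih] with x h1 h2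
    rw [h1, Pi.add_apply, h2, Finset.sum_insert hi]

theorem integrable_rpow_const_add [IsFiniteMeasure m] (κ : ℝ) (hp : 1 < p) {f : α → ℝ}
    (hf : MemLp f (ENNReal.ofReal p) m) (hf0 : ∀ x, 0 ≤ f x) :
    Integrable (fun x => (√κ + f x) ^ p) m := by
  have h1 := ((memLp_const (√κ)).add hf).integrable_norm_rpow
    (ENNReal.ofReal_pos.2 (by linarith)).ne' ENNReal.ofReal_ne_top
  refine h1.congr (Eventually.of_forall fun x => ?_)
  simp only [Pi.add_apply]
  rw [ENNReal.toReal_ofReal (by linarith),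
    Real.norm_of_nonneg (add_nonneg (Real.sqrt_nonneg κ) (hf0 x))]

theorem integrable_inner_stress [IsFiniteMeasure m] (hκ : 0 ≤ κ) (hp : 1 < p) {A B : α → Mat d}
    (hA : MemLp A (ENNReal.ofReal p) m) (hB : MemLp B (ENNReal.ofReal p) m) :
    Integrable (fun x => (inner ℝ (stress κ p (A x)) (B x) : ℝ)) m := by
  refine (integrable_rpow_const_add κ hp (hA.norm.add hB.norm)
    fun x => add_nonneg (norm_nonneg _) (norm_nonneg _)).mono'
    (((continuous_stress hκ hp).comp_aestronglyMeasurable hA.1).inner hB.1)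
    (Eventually.of_forall fun x => ?_)
  exact abs_inner_stress_le hκ hp (le_add_of_nonneg_right (norm_nonneg _))
    (le_add_of_nonneg_left (norm_nonneg _))

/-- Dominated convergence on the unit ball about `c₀`. Coordinates are used because the space of
discrete velocities carries no topology. -/
theorem continuous_integral_inner_stress [IsFiniteMeasure m] (hκ : 0 ≤ κ) (hp : 1 < p)
    {ι : Type*} [Fintype ι] {E : ι → α → Mat d} (hE : ∀ i, MemLp (E i) (ENNReal.ofReal p) m)
    {G B : α → Mat d} (hG : MemLp G (ENNReal.ofReal p) m) (hB : MemLp B (ENNReal.ofReal p) m) :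
    Continuous fun c : ι → ℝ => ∫ x, inner ℝ (stress κ p (∑ i, c i • E i x + G x)) (B x) ∂m := by
  have hS := continuous_stress (d := d) hκ hp
  rw [continuous_iff_continuousAt]
  intro c₀
  set R := ‖c₀‖ + 1
  have hR : 0 ≤ R := by positivity
  set N : α → ℝ := fun x => (∑ i, R * ‖E i x‖ + ‖G x‖) + ‖B x‖
  have hN : MemLp N (ENNReal.ofReal p) m :=
    ((memLp_finsetSum Finset.univ fun i _ => (hE i).norm.const_mul R).add hG.norm).add hB.norm
  have hsum0 : ∀ x, 0 ≤ ∑ i, R * ‖E i x‖ := fun x =>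
    Finset.sum_nonneg fun i _ => mul_nonneg hR (norm_nonneg _)
  have hN0 : ∀ x, 0 ≤ N x := fun x =>
    add_nonneg (add_nonneg (hsum0 x) (norm_nonneg _)) (norm_nonneg _)
  refine continuousAt_of_dominated (bound := fun x => (√κ + N x) ^ p) ?_ ?_
    (integrable_rpow_const_add κ hp hN hN0) (Eventually.of_forall fun x => ?_)
  · refine Eventually.of_forall fun c => ?_
    have h1 : AEStronglyMeasurable (fun x => ∑ i, c i • E i x + G x) m :=
      (Finset.aestronglyMeasurable_fun_sum _ fun i _ => (hE i).1.const_smul (c i)).add hG.1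
    exact (hS.comp_aestronglyMeasurable h1).inner hB.1
  · filter_upwards [Metric.ball_mem_nhds c₀ one_pos] with c hc
    refine Eventually.of_forall fun x => ?_
    have hcR : ‖c‖ ≤ R := by
      rw [mem_ball_iff_norm] at hc
      have := norm_le_norm_add_norm_sub' c c₀
      linarith
    refine abs_inner_stress_le hκ hp ?_ ?_
    · refine le_trans ((norm_add_le _ _).trans ?_) (le_add_of_nonneg_right (norm_nonneg _))
      gcongr
      refine (norm_sum_le _ _).trans (Finset.sum_le_sum fun i _ => ?_)
      rw [norm_smul]
      exact mul_le_mul_of_nonneg_right ((norm_le_pi_norm c i).trans hcR) (norm_nonneg _)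
    · exact le_add_of_nonneg_left (add_nonneg (hsum0 x) (norm_nonneg _))
  · have : Continuous fun c : ι → ℝ => (inner ℝ (stress κ p (∑ i, c i • E i x + G x)) (B x) : ℝ) :=
      (hS.comp (by fun_prop)).inner continuous_const
    exact this.continuousAt

end StressIntegral

namespace GradientDiscretisation

variable {d : ℕ} {O : Set (Vec d)} {p : ℝ} {X Y : Type*}
  [AddCommGroup X] [Module ℝ X] [FiniteDimensional ℝ X]
  [AddCommGroup Y] [Module ℝ Y] [FiniteDimensional ℝ Y]
  {D : GradientDiscretisation O p X Y} {Γ : ℝ≥0}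

/-! ### Consequences of stability -/

/-- Finiteness of `C_D(p')` places reconstruction and divergence in `L^{p'}`, which makes the Hölder
pairings of the scheme integrable. -/
theorem IsStable.eLpNorm_lt_top (hD : D.IsStable Γ) (v : X) :
    eLpNorm (D.recon v) (ENNReal.ofReal p.conjExponent) (volume.restrict O)
      + eLpNorm (D.dvg v) (ENNReal.ofReal p.conjExponent) (volume.restrict O)
      + eLpNorm (D.grad v) (ENNReal.ofReal p.conjExponent) (volume.restrict O) < ∞ := by
  have h1 : D.coercivityConst p.conjExponent ≤ Γ := le_add_self.trans hD.coercivity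
  have h2 := (le_iSup (fun v : X => _) v).trans h1
  rw [ENNReal.div_le_iff_le_mul (Or.inr ENNReal.coe_ne_top) (Or.inl (hD.memLp_eps v).2.ne)] at h2
  exact h2.trans_lt (ENNReal.mul_lt_top ENNReal.coe_lt_top (hD.memLp_eps v).2)

theorem IsStable.memLp_recon (hD : D.IsStable Γ) (v : X) :
    MemLp (D.recon v) (ENNReal.ofReal p.conjExponent) (volume.restrict O) :=
  ⟨(Lp.memLp _).1, (le_self_add.trans le_self_add).trans_lt (hD.eLpNorm_lt_top v)⟩

theorem IsStable.memLp_dvg (hD : D.IsStable Γ) (v : X) :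
    MemLp (D.dvg v) (ENNReal.ofReal p.conjExponent) (volume.restrict O) :=
  ⟨(Lp.memLp _).1, (le_add_self.trans le_self_add).trans_lt (hD.eLpNorm_lt_top v)⟩

theorem IsStable.integrable_pairing (hD : D.IsStable Γ) (hp : 1 < p) (q : Y) (v : X) :
    Integrable (fun x => D.chi q x * D.dvg v x) (volume.restrict O) := by
  have hc := Real.HolderConjugate.conjExponent hp
  have := hc.ennrealOfReal
  have := hc.symm.ennrealOfReal
  have hq := Lp.memLp (D.chi q)
  generalize (D.chi q : Vec d → ℝ) = f at hq ⊢
  -- The pressure has the smaller of the two exponents, so the divergence must be taken in the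
  -- larger one.
  rcases le_total p p.conjExponent with h | h
  · rw [min_eq_left h] at hq
    exact hq.integrable_mul (hD.memLp_dvg v)
  · rw [min_eq_right h] at hq
    exact hq.integrable_mul (Lp.memLp (D.dvg v))

theorem chi_add (q q' : Y) :
    D.chi (q + q') =ᵐ[volume.restrict O] fun x => D.chi q x + D.chi q' x := by
  rw [map_add]
  exact Lp.coeFn_add _ _

theorem chi_smul (c : ℝ) (q : Y) :
    D.chi (c • q) =ᵐ[volume.restrict O] fun x => c * D.chi q x := by
  rw [map_smul]
  exact Lp.coeFn_smul _ _

theorem recon_add (v v' : X) :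
    D.recon (v + v') =ᵐ[volume.restrict O] fun x => D.recon v x + D.recon v' x := by
  rw [map_add]
  exact Lp.coeFn_add _ _

theorem recon_smul (c : ℝ) (v : X) :
    D.recon (c • v) =ᵐ[volume.restrict O] fun x => c • D.recon v x := by
  rw [map_smul]
  exact Lp.coeFn_smul _ _

theorem eps_add (v v' : X) :
    D.eps (v + v') =ᵐ[volume.restrict O] fun x => D.eps v x + D.eps v' x := by
  rw [map_add]
  exact Lp.coeFn_add _ _

theorem eps_smul (c : ℝ) (v : X) :
    D.eps (c • v) =ᵐ[volume.restrict O] fun x => c • D.eps v x := by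
  rw [map_smul]
  exact Lp.coeFn_smul _ _

theorem rowMul_add (s : Vec d) (A B : Mat d) : rowMul s (A + B) = rowMul s A + rowMul s B := by
  ext j
  simp [rowMul, mul_add, Finset.sum_add_distrib]

theorem rowMul_smul (s : Vec d) (c : ℝ) (A : Mat d) : rowMul s (c • A) = c • rowMul s A := by
  ext j
  simp only [rowMul, PiLp.smul_apply, smul_eq_mul, Finset.mul_sum]
  exact Finset.sum_congr rfl fun i _ => by ring

theorem rowMul_grad_add (σ : Vec d → Vec d) (v v' : X) :
    (fun x => rowMul (σ x) (D.grad (v + v') x)) =ᵐ[volume.restrict O]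
      fun x => rowMul (σ x) (D.grad v x) + rowMul (σ x) (D.grad v' x) := by
  rw [map_add]
  filter_upwards [Lp.coeFn_add (D.grad v) (D.grad v')] with x hx
  rw [hx, Pi.add_apply, rowMul_add]

theorem rowMul_grad_smul (σ : Vec d → Vec d) (c : ℝ) (v : X) :
    (fun x => rowMul (σ x) (D.grad (c • v) x)) =ᵐ[volume.restrict O]
      fun x => c • rowMul (σ x) (D.grad v x) := by
  rw [map_smul]
  filter_upwards [Lp.coeFn_smul c (D.grad v)] with x hx
  rw [hx, Pi.smul_apply, rowMul_smul]

/-- The pairing `(χ_D q, div_D v)` as a bilinear form. -/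
def pairingForm (hD : D.IsStable Γ) (hp : 1 < p) : Y →ₗ[ℝ] X →ₗ[ℝ] ℝ :=
  LinearMap.mk₂ ℝ D.pairing
    (fun q q' v => by
      simp only [Reconstructions.pairing]
      rw [← integral_add (hD.integrable_pairing hp q v) (hD.integrable_pairing hp q' v)]
      refine integral_congr_ae ?_
      filter_upwards [D.chi_add q q'] with x hx
      rw [hx]; ring)
    (fun c q v => by
      simp only [Reconstructions.pairing, smul_eq_mul]
      rw [← integral_const_mul]
      refine integral_congr_ae ?_
      filter_upwards [D.chi_smul c q] with x hx
      rw [hx]; ring)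
    (fun q v v' => by
      simp only [Reconstructions.pairing]
      rw [← integral_add (hD.integrable_pairing hp q v) (hD.integrable_pairing hp q v')]
      refine integral_congr_ae ?_
      rw [map_add]
      filter_upwards [Lp.coeFn_add (D.dvg v) (D.dvg v')] with x hx
      rw [hx, Pi.add_apply]; ring)
    (fun c q v => by
      simp only [Reconstructions.pairing, smul_eq_mul]
      rw [← integral_const_mul]
      refine integral_congr_ae ?_
      rw [map_smul]
      filter_upwards [Lp.coeFn_smul c (D.dvg v)] with x hx
      rw [hx, Pi.smul_apply, smul_eq_mul]; ring)

@[simp]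
theorem pairingForm_apply (hD : D.IsStable Γ) (hp : 1 < p) (q : Y) (v : X) :
    pairingForm hD hp q v = D.pairing q v := rfl

section FiniteMeasure

variable [IsFiniteMeasure (volume.restrict O)]

theorem integrable_chi (hp : 1 < p) (q : Y) : Integrable (D.chi q) (volume.restrict O) := by
  refine (Lp.memLp (D.chi q)).integrable ?_
  rw [← ENNReal.ofReal_one]
  exact ENNReal.ofReal_le_ofReal (le_min hp.le (Real.HolderConjugate.conjExponent hp).symm.lt.le)

/-- The mean-value free discrete pressures as a subspace. -/
def pressureSpace (D : GradientDiscretisation O p X Y) (hp : 1 < p) : Submodule ℝ Y where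
  carrier := D.Y0
  add_mem' {q q'} hq hq' := by
    change ∫ x in O, D.chi (q + q') x = 0
    rw [integral_congr_ae (D.chi_add q q'), integral_add (integrable_chi hp q) (integrable_chi hp q')]
    have hq : ∫ x in O, D.chi q x = 0 := hq
    have hq' : ∫ x in O, D.chi q' x = 0 := hq'
    rw [hq, hq', add_zero]
  zero_mem' := by
    change ∫ x in O, D.chi 0 x = 0
    rw [map_zero, integral_congr_ae (Lp.coeFn_zero _ _ _)]
    simp
  smul_mem' c q hq := by
    change ∫ x in O, D.chi (c • q) x = 0
    have hq : ∫ x in O, D.chi q x = 0 := hq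
    rw [integral_congr_ae (D.chi_smul c q), integral_const_mul, hq, mul_zero]

/-- A functional that vanishes on the discretely divergence free velocities is represented by a
mean-value free discrete pressure. -/
theorem IsStable.exists_pressure (hD : D.IsStable Γ) (hp : 1 < p) (K : X →ₗ[ℝ] ℝ)
    (hK : ∀ v ∈ D.E0, K v = 0) : ∃ q ∈ D.Y0, ∀ v, K v = D.pairing q v := by
  let L : D.pressureSpace hp → X →ₗ[ℝ] ℝ := fun q => pairingForm hD hp q
  -- The space `E0` is the common kernel of the pairings with `Y0`; in finite dimensions the
  -- functionals vanishing on it are spanned by these pairings, which already form a subspace.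
  have hspan := FiniteDimensional.mem_span_of_iInf_ker_le_ker (L := L) (K := K) fun v hv => by
    simp only [Submodule.mem_iInf, LinearMap.mem_ker] at hv ⊢
    exact hK v fun q hq => hv ⟨q, hq⟩
  have hrange : Set.range L =
      ((pairingForm hD hp).comp (D.pressureSpace hp).subtype).range := by
    ext; rfl
  rw [hrange, Submodule.span_eq] at hspan
  obtain ⟨q, hq⟩ := hspan
  exact ⟨q, q.2, fun v => by rw [← hq]; rfl⟩

end FiniteMeasure

/-- The discretely divergence free velocities as a subspace. -/
def solenoidalSpace (hD : D.IsStable Γ) (hp : 1 < p) : Submodule ℝ X where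
  carrier := D.E0
  add_mem' {v v'} hv hv' q hq := by
    have := (pairingForm hD hp q).map_add v v'
    simp only [pairingForm_apply] at this
    rw [this, hv q hq, hv' q hq, add_zero]
  zero_mem' q _ := (pairingForm hD hp q).map_zero
  smul_mem' c v hv q hq := by
    have := (pairingForm hD hp q).map_smul c v
    simp only [pairingForm_apply] at this
    rw [this, hv q hq, smul_zero]

/-! ### The forms of the scheme -/

theorem IsStable.integrable_noise (hD : D.IsStable Γ) (hp : 1 < p) {σ : Vec d → Vec d}
    (hσ : MemLp σ ∞ (volume.restrict O)) (v ξ : X) :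
    Integrable (fun x => (inner ℝ (rowMul (σ x) (D.grad v x)) (D.recon ξ x) : ℝ))
      (volume.restrict O) := by
  have := (Real.HolderConjugate.conjExponent hp).ennrealOfReal
  exact integrable_inner_of_memLp (memLp_rowMul hσ (Lp.memLp (D.grad v))) (hD.memLp_recon ξ)

/-- The form `(σᵀ ∇_D v, Π_D ξ)`. -/
def transportForm (hD : D.IsStable Γ) (hp : 1 < p) {σ : Vec d → Vec d}
    (hσ : MemLp σ ∞ (volume.restrict O)) : X →ₗ[ℝ] X →ₗ[ℝ] ℝ :=
  LinearMap.mk₂ ℝ (fun v ξ => ∫ x in O, inner ℝ (rowMul (σ x) (D.grad v x)) (D.recon ξ x))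
    (fun v v' ξ => by
      rw [← integral_add (hD.integrable_noise hp hσ v ξ) (hD.integrable_noise hp hσ v' ξ)]
      refine integral_congr_ae ?_
      filter_upwards [D.rowMul_grad_add σ v v'] with x hx
      rw [hx, inner_add_left])
    (fun c v ξ => by
      rw [smul_eq_mul, ← integral_const_mul]
      refine integral_congr_ae ?_
      filter_upwards [D.rowMul_grad_smul σ c v] with x hx
      rw [hx, real_inner_smul_left])
    (fun v ξ ξ' => by
      rw [← integral_add (hD.integrable_noise hp hσ v ξ) (hD.integrable_noise hp hσ v ξ')]
      refine integral_congr_ae ?_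
      filter_upwards [D.recon_add ξ ξ'] with x hx
      rw [hx, inner_add_right])
    (fun c v ξ => by
      rw [smul_eq_mul, ← integral_const_mul]
      refine integral_congr_ae ?_
      filter_upwards [D.recon_smul c ξ] with x hx
      rw [hx, real_inner_smul_right])

/-- The noise coefficient `B_D^σ` as a bilinear form. -/
def noiseForm (hD : D.IsStable Γ) (hp : 1 < p) {σ : Vec d → Vec d}
    (hσ : MemLp σ ∞ (volume.restrict O)) : X →ₗ[ℝ] X →ₗ[ℝ] ℝ :=
  (1 / 2 : ℝ) • transportForm hD hp hσ - (1 / 2 : ℝ) • (transportForm hD hp hσ).flip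

@[simp]
theorem noiseForm_apply (hD : D.IsStable Γ) (hp : 1 < p) {σ : Vec d → Vec d}
    (hσ : MemLp σ ∞ (volume.restrict O)) (v ξ : X) :
    noiseForm hD hp hσ v ξ = D.noise σ v ξ := by
  simp only [noiseForm, noise, transportForm, LinearMap.sub_apply, LinearMap.smul_apply,
    LinearMap.flip_apply, LinearMap.mk₂_apply, smul_eq_mul, real_inner_comm]

theorem noiseForm_self (hD : D.IsStable Γ) (hp : 1 < p) {σ : Vec d → Vec d}
    (hσ : MemLp σ ∞ (volume.restrict O)) (v : X) : noiseForm hD hp hσ v v = 0 := by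
  simp [noiseForm]

/-- The functional `ξ ↦ (h, Π_D ξ)`. -/
def forceForm (D : GradientDiscretisation O p X Y) {h : Vec d → Vec d}
    (hh : MemLp h 2 (volume.restrict O)) : X →ₗ[ℝ] ℝ where
  toFun ξ := ∫ x in O, inner ℝ (h x) (D.recon ξ x)
  map_add' ξ ξ' := by
    rw [← integral_add (integrable_inner_of_memLp hh (Lp.memLp (D.recon ξ)))
      (integrable_inner_of_memLp hh (Lp.memLp (D.recon ξ')))]
    refine integral_congr_ae ?_
    filter_upwards [D.recon_add ξ ξ'] with x hx
    rw [hx, inner_add_right]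
  map_smul' c ξ := by
    rw [RingHom.id_apply, smul_eq_mul, ← integral_const_mul]
    refine integral_congr_ae ?_
    filter_upwards [D.recon_smul c ξ] with x hx
    rw [hx, real_inner_smul_right]

section Stress

variable [IsFiniteMeasure (volume.restrict O)] {κ : ℝ} {G : Vec d → Mat d}

theorem integrable_inner_stress_eps (hκ : 0 ≤ κ) (hp : 1 < p)
    (hG : MemLp G (ENNReal.ofReal p) (volume.restrict O)) (w ξ : X) :
    Integrable (fun x => (inner ℝ (stress κ p (D.eps w x + G x)) (D.eps ξ x) : ℝ))
      (volume.restrict O) :=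
  integrable_inner_stress hκ hp ((Lp.memLp (D.eps w)).add hG) (Lp.memLp (D.eps ξ))

/-- The functional `ξ ↦ (S(ε_D w + G), ε_D ξ)`. -/
def stressForm (D : GradientDiscretisation O p X Y) (hκ : 0 ≤ κ) (hp : 1 < p)
    (hG : MemLp G (ENNReal.ofReal p) (volume.restrict O)) (w : X) : X →ₗ[ℝ] ℝ where
  toFun ξ := ∫ x in O, inner ℝ (stress κ p (D.eps w x + G x)) (D.eps ξ x)
  map_add' ξ ξ' := by
    rw [← integral_add (integrable_inner_stress_eps hκ hp hG w ξ)
      (integrable_inner_stress_eps hκ hp hG w ξ')]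
    refine integral_congr_ae ?_
    filter_upwards [D.eps_add ξ ξ'] with x hx
    rw [hx, inner_add_right]
  map_smul' c ξ := by
    rw [RingHom.id_apply, smul_eq_mul, ← integral_const_mul]
    refine integral_congr_ae ?_
    filter_upwards [D.eps_smul c ξ] with x hx
    rw [hx, real_inner_smul_right]

theorem stressForm_apply (hκ : 0 ≤ κ) (hp : 1 < p)
    (hG : MemLp G (ENNReal.ofReal p) (volume.restrict O)) (w ξ : X) :
    D.stressForm hκ hp hG w ξ
      = ∫ x in O, inner ℝ (stress κ p (D.eps w x + G x)) (D.eps ξ x) := rfl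

theorem stressForm_sub_apply (hκ : 0 ≤ κ) (hp : 1 < p)
    (hG : MemLp G (ENNReal.ofReal p) (volume.restrict O)) (v w : X) :
    (D.stressForm hκ hp hG v - D.stressForm hκ hp hG w) (v - w)
      = ∫ x in O, inner ℝ (stress κ p (D.eps v x + G x) - stress κ p (D.eps w x + G x))
          ((D.eps v x + G x) - (D.eps w x + G x)) := by
  rw [LinearMap.sub_apply, stressForm_apply, stressForm_apply,
    ← integral_sub (integrable_inner_stress_eps hκ hp hG v _)
      (integrable_inner_stress_eps hκ hp hG w _)]
  refine integral_congr_ae ?_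
  rw [map_sub]
  filter_upwards [Lp.coeFn_sub (D.eps v) (D.eps w)] with x hx
  rw [hx, Pi.sub_apply, inner_sub_left, add_sub_add_right_eq_sub]

theorem stressForm_monotone (hκ : 0 ≤ κ) (hp : 1 < p)
    (hG : MemLp G (ENNReal.ofReal p) (volume.restrict O)) (v w : X) :
    0 ≤ (D.stressForm hκ hp hG v - D.stressForm hκ hp hG w) (v - w) := by
  rw [stressForm_sub_apply]
  exact integral_nonneg fun x => inner_stress_sub_nonneg hκ hp _ _

/-- A nonnegative integrand with zero integral vanishes almost everywhere. Pointwise strict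
monotonicity then identifies the symmetric gradients, and definiteness of `eps` the velocities. -/
theorem eq_of_stressForm_sub_eq_zero (hκ : 0 ≤ κ) (hp : 1 < p)
    (hG : MemLp G (ENNReal.ofReal p) (volume.restrict O)) {v w : X}
    (h : (D.stressForm hκ hp hG v - D.stressForm hκ hp hG w) (v - w) = 0) : v = w := by
  have hint : Integrable (fun x =>
      (inner ℝ (stress κ p (D.eps v x + G x) - stress κ p (D.eps w x + G x))
          ((D.eps v x + G x) - (D.eps w x + G x)) : ℝ)) (volume.restrict O) := by
    have h1 := (Lp.memLp (D.eps v)).add hG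
    have h2 := (Lp.memLp (D.eps w)).add hG
    have h3 := (integrable_inner_stress hκ hp h1 (h1.sub h2)).sub
      (integrable_inner_stress hκ hp h2 (h1.sub h2))
    refine h3.congr (Eventually.of_forall fun x => ?_)
    simp only [Pi.sub_apply, Pi.add_apply, inner_sub_left]
  rw [stressForm_sub_apply,
    integral_eq_zero_iff_of_nonneg (fun x => inner_stress_sub_nonneg hκ hp _ _) hint] at h
  have heq : D.eps v = D.eps w := by
    refine Lp.ext ?_
    filter_upwards [h] with x hx
    by_contra hne
    exact (inner_stress_sub_pos hκ hp fun h => hne (add_right_cancel h)).ne' hx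
  rw [← sub_eq_zero]
  exact D.eps_definite _ (by rw [map_sub, heq, sub_self])

theorem continuous_stressForm_comp {H : Type*} [NormedAddCommGroup H] [NormedSpace ℝ H]
    [FiniteDimensional ℝ H] (f : H →ₗ[ℝ] X) (hκ : 0 ≤ κ) (hp : 1 < p)
    (hG : MemLp G (ENNReal.ofReal p) (volume.restrict O)) (ξ : X) :
    Continuous fun w => D.stressForm hκ hp hG (f w) ξ := by
  let B := Module.finBasis ℝ H
  have h1 := continuous_integral_inner_stress hκ hp (fun i => Lp.memLp (D.eps (f (B i)))) hG
    (Lp.memLp (D.eps ξ))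
  have h2 : Continuous fun w => (B.equivFun w : Fin (Module.finrank ℝ H) → ℝ) :=
    B.equivFun.toLinearMap.continuous_of_finiteDimensional
  refine (h1.comp h2).congr fun w => ?_
  rw [Function.comp_apply, stressForm_apply]
  refine integral_congr_ae ?_
  have e : D.eps (f w) = ∑ i, B.equivFun w i • D.eps (f (B i)) := by
    conv_lhs => rw [← B.sum_equivFun w]
    simp only [map_sum, map_smul]
  rw [e]
  have h3 : ∀ᵐ x ∂volume.restrict O, ∀ i,
      (B.equivFun w i • D.eps (f (B i)) : Lp (Mat d) (ENNReal.ofReal p) (volume.restrict O)) x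
        = B.equivFun w i • D.eps (f (B i)) x :=
    ae_all_iff.2 fun i => Lp.coeFn_smul _ _
  filter_upwards [h3, coeFn_lp_sum Finset.univ
    fun i => B.equivFun w i • D.eps (f (B i))] with x hx hs
  rw [hs]
  simp only [hx]

end Stress

end GradientDiscretisation

namespace GradientDiscretisation

variable {d : ℕ} {O : Set (Vec d)} {p : ℝ} {X Y : Type*}
  [AddCommGroup X] [Module ℝ X] [FiniteDimensional ℝ X]
  [AddCommGroup Y] [Module ℝ Y] [FiniteDimensional ℝ Y]
  {D : GradientDiscretisation O p X Y} {Γ : ℝ≥0}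

/-! ### The velocity space as a subspace of `L²` -/

/-- The reconstruction restricted to the discretely divergence free velocities. -/
def solenoidalRecon (hD : D.IsStable Γ) (hp : 1 < p) : solenoidalSpace hD hp →ₗ[ℝ] L2 O :=
  D.recon.domRestrict (solenoidalSpace hD hp)

theorem solenoidalRecon_injective (hD : D.IsStable Γ) (hp : 1 < p) :
    Function.Injective (solenoidalRecon hD hp) :=
  fun v w h => Subtype.ext (D.recon_injOn v.2 w.2 h)

/-- The reconstructions of the discretely divergence free velocities. -/
abbrev velocitySpace (hD : D.IsStable Γ) (hp : 1 < p) : Submodule ℝ (L2 O) :=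
  (solenoidalRecon hD hp).range

/-- The discrete velocity with a given reconstruction. -/
def lift (hD : D.IsStable Γ) (hp : 1 < p) : velocitySpace hD hp →ₗ[ℝ] X :=
  (solenoidalSpace hD hp).subtype.comp
    (LinearEquiv.ofInjective _ (solenoidalRecon_injective hD hp)).symm.toLinearMap

theorem lift_mem (hD : D.IsStable Γ) (hp : 1 < p) (x : velocitySpace hD hp) :
    lift hD hp x ∈ D.E0 :=
  ((LinearEquiv.ofInjective _ (solenoidalRecon_injective hD hp)).symm x).2

@[simp]
theorem recon_lift (hD : D.IsStable Γ) (hp : 1 < p) (x : velocitySpace hD hp) :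
    D.recon (lift hD hp x) = x :=
  congrArg Subtype.val
    ((LinearEquiv.ofInjective _ (solenoidalRecon_injective hD hp)).apply_symm_apply x)

theorem lift_injective (hD : D.IsStable Γ) (hp : 1 < p) : Function.Injective (lift hD hp) :=
  fun x y h => Subtype.ext (by rw [← recon_lift hD hp x, h, recon_lift])

theorem exists_lift_eq (hD : D.IsStable Γ) (hp : 1 < p) {v : X} (hv : v ∈ D.E0) :
    ∃ x : velocitySpace hD hp, lift hD hp x = v := by
  refine ⟨⟨D.recon v, ⟨⟨v, hv⟩, rfl⟩⟩, D.recon_injOn (lift_mem hD hp _) hv ?_⟩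
  rw [recon_lift]

theorem smul_add_mem_E0 (hD : D.IsStable Γ) (hp : 1 < p) (c : ℝ) {v w : X} (hv : v ∈ D.E0)
    (hw : w ∈ D.E0) : c • (v + w) ∈ D.E0 :=
  (solenoidalSpace hD hp).smul_mem c ((solenoidalSpace hD hp).add_mem hv hw)

/-! ### The initial step -/

/-- The velocity is the orthogonal projection of `u`; its residual annihilates `E0` and is therefore
given by a pressure. -/
theorem IsStable.exists_isHelmholtz [IsFiniteMeasure (volume.restrict O)] (hD : D.IsStable Γ) (hp : 1 < p) (u : L2 O) :
    ∃ s : X × Y, D.IsHelmholtz u s := by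
  let x := (velocitySpace hD hp).orthogonalProjectionOnto u
  obtain ⟨q, hq, hK⟩ := hD.exists_pressure hp
    ((innerₛₗ ℝ (u - D.recon (lift hD hp x))).comp D.recon) fun v hv => by
      obtain ⟨y, rfl⟩ := exists_lift_eq hD hp hv
      simp only [LinearMap.comp_apply, innerₛₗ_apply_apply, recon_lift]
      rw [real_inner_comm]
      exact (velocitySpace hD hp).inner_right_of_mem_orthogonal y.2
        ((velocitySpace hD hp).sub_starProjection_mem_orthogonal u)
  refine ⟨(lift hD hp x, q), hq, fun ξ => ?_, fun q hq => lift_mem hD hp x q hq⟩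
  rw [← hK, LinearMap.comp_apply, innerₛₗ_apply_apply, inner_sub_left]
  ring

theorem IsHelmholtz.recon_eq (hD : D.IsStable Γ) (hp : 1 < p) {u : L2 O} {s : X × Y}
    (hs : D.IsHelmholtz u s) :
    s.1 = lift hD hp ((velocitySpace hD hp).orthogonalProjectionOnto u) := by
  obtain ⟨hq, heq, hdiv⟩ := hs
  obtain ⟨x, hx⟩ := exists_lift_eq hD hp (v := s.1) hdiv
  rw [← hx]
  congr 1
  refine Subtype.ext ?_
  symm
  refine Submodule.eq_starProjection_of_mem_of_inner_eq_zero x.2 fun w hw => ?_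
  have h := heq (lift hD hp ⟨w, hw⟩)
  have h0 : D.pairing s.2 (lift hD hp ⟨w, hw⟩) = 0 := lift_mem hD hp ⟨w, hw⟩ s.2 hq
  rw [h0, add_zero, ← hx, recon_lift, recon_lift] at h
  rw [inner_sub_left, h, sub_self]

/-! ### The time steps -/

section Step

variable {κ : ℝ} {g σ : Vec d → Vec d}

/-- The noise coefficient of the scheme on the velocity space. -/
def diffusion (hD : D.IsStable Γ) (hp : 1 < p) (hσ : MemLp σ ∞ (volume.restrict O)) :
    velocitySpace hD hp →ₗ[ℝ] velocitySpace hD hp →ₗ[ℝ] ℝ :=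
  (noiseForm hD hp hσ).compl₁₂ (lift hD hp) (lift hD hp)

theorem diffusion_apply (hD : D.IsStable Γ) (hp : 1 < p) (hσ : MemLp σ ∞ (volume.restrict O))
    (v ξ : velocitySpace hD hp) :
    diffusion hD hp hσ v ξ = D.noise σ (lift hD hp v) (lift hD hp ξ) := by
  rw [diffusion, LinearMap.compl₁₂_apply, noiseForm_apply]

theorem diffusion_self (hD : D.IsStable Γ) (hp : 1 < p) (hσ : MemLp σ ∞ (volume.restrict O))
    (v : velocitySpace hD hp) : diffusion hD hp hσ v v = 0 := by
  rw [diffusion, LinearMap.compl₁₂_apply, noiseForm_self]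

/-- The additive noise of the scheme on the velocity space. -/
def forcing (hD : D.IsStable Γ) (hp : 1 < p) (hh : MemLp (advect O σ g) 2 (volume.restrict O)) :
    velocitySpace hD hp →ₗ[ℝ] ℝ :=
  (D.forceForm hh).comp (lift hD hp)

variable [IsFiniteMeasure (volume.restrict O)]

/-- The dissipation of the scheme on the velocity space. -/
def drift (hD : D.IsStable Γ) (hκ : 0 ≤ κ) (hp : 1 < p)
    (hG : MemLp (symGradient O g) (ENNReal.ofReal p) (volume.restrict O)) (τ : ℝ)
    (w : velocitySpace hD hp) : velocitySpace hD hp →ₗ[ℝ] ℝ :=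
  τ • (D.stressForm hκ hp hG (lift hD hp w)).comp (lift hD hp)

theorem drift_apply (hD : D.IsStable Γ) (hκ : 0 ≤ κ) (hp : 1 < p)
    (hG : MemLp (symGradient O g) (ENNReal.ofReal p) (volume.restrict O)) (τ : ℝ)
    (w ξ : velocitySpace hD hp) :
    drift hD hκ hp hG τ w ξ = τ * D.stressForm hκ hp hG (lift hD hp w) (lift hD hp ξ) := by
  rw [drift, LinearMap.smul_apply, LinearMap.comp_apply, smul_eq_mul]

section Properties

variable (hD : D.IsStable Γ) (hκ : 0 ≤ κ) (hp : 1 < p)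
  (hG : MemLp (symGradient O g) (ENNReal.ofReal p) (volume.restrict O)) {τ : ℝ}

theorem continuous_drift (ξ : velocitySpace hD hp) :
    Continuous fun w => drift hD hκ hp hG τ w ξ := by
  simp only [drift_apply]
  exact continuous_const.mul (continuous_stressForm_comp (lift hD hp) hκ hp hG (lift hD hp ξ))

theorem drift_sub_apply (v w : velocitySpace hD hp) :
    (drift hD hκ hp hG τ v - drift hD hκ hp hG τ w) (v - w)
      = τ * (D.stressForm hκ hp hG (lift hD hp v) - D.stressForm hκ hp hG (lift hD hp w))
          (lift hD hp v - lift hD hp w) := by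
  simp only [LinearMap.sub_apply, drift_apply, mul_sub, map_sub (lift hD hp)]

theorem drift_monotone (hτ : 0 ≤ τ) (v w : velocitySpace hD hp) :
    0 ≤ (drift hD hκ hp hG τ v - drift hD hκ hp hG τ w) (v - w) := by
  rw [drift_sub_apply]
  exact mul_nonneg hτ (stressForm_monotone hκ hp hG _ _)

theorem eq_of_drift_sub_eq_zero (hτ : 0 < τ) (v w : velocitySpace hD hp)
    (h : (drift hD hκ hp hG τ v - drift hD hκ hp hG τ w) (v - w) = 0) : v = w := by
  rw [drift_sub_apply] at h
  exact lift_injective hD hp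
    (eq_of_stressForm_sub_eq_zero hκ hp hG ((mul_eq_zero.1 h).resolve_left hτ.ne'))

variable (hσ : MemLp σ ∞ (volume.restrict O)) (hh : MemLp (advect O σ g) 2 (volume.restrict O))
  {z : ℝ}

/-- The momentum equation, tested with a discretely divergence free velocity. -/
theorem crankNicolson_iff {x x' : velocitySpace hD hp} :
    CrankNicolson (drift hD hκ hp hG τ) (diffusion hD hp hσ) (forcing hD hp hh) z x x' ↔
      ∀ ξ ∈ D.E0,
        inner ℝ (D.recon (lift hD hp x') - D.recon (lift hD hp x)) (D.recon ξ)
          + τ * D.stressForm hκ hp hG ((1 / 2 : ℝ) • (lift hD hp x' + lift hD hp x)) ξ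
        = (D.noise σ ((1 / 2 : ℝ) • (lift hD hp x' + lift hD hp x)) ξ + D.forceForm hh ξ) * z := by
  have h := crankNicolson_iff_map (a := drift hD hκ hp hG τ) (b := diffusion hD hp hσ)
    (l := forcing hD hp hh) (z := z) (x := x) (x' := x') (lift hD hp) D.recon
    (A := fun w ξ => τ * D.stressForm hκ hp hG w ξ) (B := fun w ξ => D.noise σ w ξ)
    (f := fun ξ => D.forceForm hh ξ)
    (fun x y => by rw [recon_lift, recon_lift, Submodule.coe_inner])
    (drift_apply hD hκ hp hG τ) (diffusion_apply hD hp hσ) (fun ξ => rfl)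
  rw [h]
  constructor
  · intro h ξ hξ
    obtain ⟨ξ, rfl⟩ := exists_lift_eq hD hp hξ
    exact h ξ
  · intro h ξ
    exact h _ (lift_mem hD hp ξ)

theorem IsStep.exists_crankNicolson {x : velocitySpace hD hp} {q : Y} (hq : q ∈ D.Y0)
    {s' : X × Y} (h : D.IsStep κ τ g σ z (lift hD hp x, q) s') :
    ∃ x', s'.1 = lift hD hp x' ∧
      CrankNicolson (drift hD hκ hp hG τ) (diffusion hD hp hσ) (forcing hD hp hh) z x x' := by
  obtain ⟨hq', heq, hdiv⟩ := h
  have hmem : s'.1 ∈ D.E0 := by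
    -- The scheme constrains the divergence of the midpoint only; the new velocity inherits it
    -- because the old one is already in `E0`.
    have h1 : (2 : ℝ) • ((1 / 2 : ℝ) • (s'.1 + lift hD hp x)) - lift hD hp x ∈
        solenoidalSpace hD hp :=
      (solenoidalSpace hD hp).sub_mem ((solenoidalSpace hD hp).smul_mem _ hdiv) (lift_mem hD hp x)
    have e : (2 : ℝ) • ((1 / 2 : ℝ) • (s'.1 + lift hD hp x)) - lift hD hp x = s'.1 := by
      rw [smul_smul]; norm_num
    rw [e] at h1
    exact h1
  obtain ⟨x', hx'⟩ := exists_lift_eq hD hp hmem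
  refine ⟨x', hx'.symm, (crankNicolson_iff hD hκ hp hG hσ hh).2 fun ξ hξ => ?_⟩
  have h1 := heq ξ
  have h2 : D.pairing s'.2 ξ = 0 := hξ _ hq'
  have h3 : D.pairing q ξ = 0 := hξ _ hq
  simp only [h2, h3, ← hx', sub_zero] at h1
  exact h1

end Properties

theorem exists_isStep (hD : D.IsStable Γ) (hκ : 0 ≤ κ) (hp : 1 < p)
    (hG : MemLp (symGradient O g) (ENNReal.ofReal p) (volume.restrict O))
    (hσ : MemLp σ ∞ (volume.restrict O)) (hh : MemLp (advect O σ g) 2 (volume.restrict O))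
    {τ z : ℝ} (hτ : 0 ≤ τ) (x : velocitySpace hD hp) {q : Y} (hq : q ∈ D.Y0) :
    ∃ s', D.IsStep κ τ g σ z (lift hD hp x, q) s' := by
  obtain ⟨x', hx'⟩ := exists_crankNicolson (continuous_drift hD hκ hp hG)
    (drift_monotone hD hκ hp hG hτ) (diffusion_self hD hp hσ) (forcing hD hp hh) z x
  rw [crankNicolson_iff] at hx'
  set w := (1 / 2 : ℝ) • (lift hD hp x' + lift hD hp x) with hw
  obtain ⟨r, hr, hK⟩ := hD.exists_pressure hp
    ((innerₛₗ ℝ (D.recon (lift hD hp x') - D.recon (lift hD hp x))).comp D.recon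
      + τ • D.stressForm hκ hp hG w - z • (noiseForm hD hp hσ w + D.forceForm hh)) fun v hv => by
      have := hx' v hv
      simp only [LinearMap.sub_apply, LinearMap.add_apply, LinearMap.smul_apply,
        LinearMap.comp_apply, innerₛₗ_apply_apply, noiseForm_apply, smul_eq_mul]
      linarith
  -- The momentum equation contains the pressure increment, which is `r`.
  refine ⟨(lift hD hp x', r + q), (D.pressureSpace hp).add_mem hr hq, fun ξ => ?_, fun q' hq' =>
    smul_add_mem_E0 hD hp _ (lift_mem hD hp x') (lift_mem hD hp x) q' hq'⟩
  have h1 := hK ξ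
  simp only [LinearMap.sub_apply, LinearMap.add_apply, LinearMap.smul_apply, stressForm_apply,
    LinearMap.comp_apply, innerₛₗ_apply_apply, noiseForm_apply, smul_eq_mul] at h1
  have h2 : D.pairing (r + q) ξ = D.pairing r ξ + D.pairing q ξ := by
    simp only [← pairingForm_apply hD hp, map_add, LinearMap.add_apply]
  have h3 : D.forceForm hh ξ = ∫ x in O, inner ℝ (advect O σ g x) (D.recon ξ x) := rfl
  simp only [← hw, h2]
  rw [h3] at h1
  linarith

end Step

/-! ### The scheme -/

/-- The trajectory of a solution operator of time steps with increments `z`. -/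
def trajectory {H : Type*} (step : ℝ → H → H) (x : H) (z : ℕ → ℝ) : ℕ → H
  | 0 => x
  | n + 1 => step (z n) (trajectory step x z n)

theorem continuous_trajectory {H : Type*} [TopologicalSpace H] {step : ℝ → H → H}
    (hstep : Continuous fun q : ℝ × H => step q.1 q.2) (n : ℕ) :
    Continuous fun q : H × (ℕ → ℝ) => trajectory step q.1 q.2 n := by
  induction n with
  | zero => exact continuous_fst
  | succ n ih =>
    exact hstep.comp (((continuous_apply n).comp continuous_snd).prodMk ih)

/-- Whichever solutions `Classical.epsilon` selects, their velocities are determined. Of the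
pressure only membership in `Y0` has to be carried along, since it then drops out against `E0`. -/
theorem scheme_eq_lift_trajectory [IsFiniteMeasure (volume.restrict O)] {κ : ℝ}
    {g σ : Vec d → Vec d} (hD : D.IsStable Γ) (hκ : 0 ≤ κ) (hp : 1 < p)
    (hG : MemLp (symGradient O g) (ENNReal.ofReal p) (volume.restrict O)) {τ : ℝ} (hτ : 0 ≤ τ)
    (hσ : MemLp σ ∞ (volume.restrict O)) (hh : MemLp (advect O σ g) 2 (volume.restrict O))
    {step : ℝ → velocitySpace hD hp → velocitySpace hD hp}
    (hstep : ∀ z x, CrankNicolson (drift hD hκ hp hG τ) (diffusion hD hp hσ) (forcing hD hp hh)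
      z x (step z x)) (z : ℕ → ℝ) (u : L2 O) (n : ℕ) :
    (D.scheme κ τ g σ z u n).1 = lift hD hp
        (trajectory step ((velocitySpace hD hp).orthogonalProjectionOnto u) z n) ∧
      (D.scheme κ τ g σ z u n).2 ∈ D.Y0 := by
  induction n with
  | zero =>
    have h : D.IsHelmholtz u (D.scheme κ τ g σ z u 0) :=
      Classical.epsilon_spec (hD.exists_isHelmholtz hp u)
    exact ⟨h.recon_eq hD hp, h.1⟩
  | succ n ih =>
    obtain ⟨ih₁, ih₂⟩ := ih
    set s := D.scheme κ τ g σ z u n with hs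
    have hs' : s = (lift hD hp
        (trajectory step ((velocitySpace hD hp).orthogonalProjectionOnto u) z n), s.2) :=
      Prod.ext ih₁ rfl
    have h : D.IsStep κ τ g σ (z n) s (D.scheme κ τ g σ z u (n + 1)) := by
      refine Classical.epsilon_spec (p := D.IsStep κ τ g σ (z n) s) ?_
      rw [hs']
      exact exists_isStep hD hκ hp hG hσ hh hτ _ ih₂
    rw [hs'] at h
    obtain ⟨x', hx', hCN⟩ := h.exists_crankNicolson hD hκ hp hG hσ hh ih₂
    refine ⟨?_, h.1⟩
    rw [hx', CrankNicolson.unique (drift_monotone hD hκ hp hG hτ) (diffusion_self hD hp hσ)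
      hCN (hstep _ _)]
    rfl

end GradientDiscretisation

/-! ### Wiener increments -/

theorem aemeasurable_increments {Ω : Type*} [MeasurableSpace Ω] {P : Measure Ω}
    {W : ℝ≥0 → Ω → ℝ} (hW : IsBrownianReal W P) (τ : ℝ≥0) :
    AEMeasurable (GradientDiscretisation.increments W τ) P :=
  aemeasurable_pi_lambda _ fun _ => (hW.aemeasurable _).sub (hW.aemeasurable _)

theorem map_increments_apply {Ω : Type*} [MeasurableSpace Ω] {P : Measure Ω}
    {W : ℝ≥0 → Ω → ℝ} (hW : IsBrownianReal W P) (τ : ℝ≥0) (n : ℕ) :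
    P.map (fun ω => GradientDiscretisation.increments W τ ω n) = gaussianReal 0 τ := by
  have h := (hW.hasLaw_sub ((n + 1 : ℕ) * τ) (n * τ)).map_eq
  have e : nndist (((n + 1 : ℕ) * τ : ℝ≥0) : ℝ) ((n * τ : ℝ≥0) : ℝ) = τ := by
    ext
    rw [coe_nndist, Real.dist_eq]
    push_cast
    rw [show ((n : ℝ) + 1) * τ - n * τ = τ by ring, NNReal.abs_eq]
  exact h.trans (congrArg _ e)

end StochStokes

end

/-! ### Uniqueness of the invariant measure -/

theorem theorem4p4 {d : ℕ} {O : Set (StochStokes.Vec d)}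
    (hO_open : IsOpen O) (hO_conn : IsConnected O) (hO_bdd : Bornology.IsBounded O)
    {p κ : ℝ} (hp : 1 < p) (hκ : 0 ≤ κ)
    {g σ : StochStokes.Vec d → StochStokes.Vec d}
    (hg : StochStokes.MemSobolevSolenoidal O 2 ∞ g)
    (hσ : StochStokes.MemSobolevSolenoidal O 1 ∞ σ)
    {X Y : Type*} [AddCommGroup X] [Module ℝ X] [FiniteDimensional ℝ X]
    [AddCommGroup Y] [Module ℝ Y] [FiniteDimensional ℝ Y]
    (D : StochStokes.GradientDiscretisation O p X Y)
    {Γ : ℝ≥0} (hΓ : 1 ≤ Γ) (hD : D.IsStable Γ)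
    {τ : ℝ≥0} (hτ : 0 < τ)
    {Ω : Type*} [MeasurableSpace Ω] (P : Measure Ω) [IsProbabilityMeasure P]
    {W : ℝ≥0 → Ω → ℝ} (hW : IsBrownianReal W P)
    (μ ν : Measure (StochStokes.L2 O)) [IsProbabilityMeasure μ] [IsProbabilityMeasure ν]
    (hμ : StochStokes.IsInvariant (D.semigroup κ τ g σ P W) μ)
    (hν : StochStokes.IsInvariant (D.semigroup κ τ g σ P W) ν) :
    μ = ν := by
  open StochStokes StochStokes.GradientDiscretisation in
  have hfin : IsFiniteMeasure (volume.restrict O) :=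
    isFiniteMeasure_restrict.2 hO_bdd.measure_lt_top.ne
  have hσ' := hσ.memLp hO_open
  have hG : MemLp (symGradient O g) (ENNReal.ofReal p) (volume.restrict O) :=
    (hg.memLp_symGradient hO_open one_le_two).mono_exponent le_top
  have hh : MemLp (advect O σ g) 2 (volume.restrict O) :=
    (memLp_advect hσ' hO_open one_le_two hg).mono_exponent le_top
  have hτ' : (0 : ℝ) < τ := by exact_mod_cast hτ
  have hmono := drift_monotone hD hκ hp hG hτ'.le
  have hself := diffusion_self hD hp hσ'
  choose step hstep using exists_crankNicolson (continuous_drift hD hκ hp hG (τ := τ)) hmono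
    hself (forcing hD hp hh)
  -- The random dynamical system on all of `L2 O`; at time zero it is the orthogonal projection onto
  -- the velocity space.
  set Φ : ℕ → L2 O × (ℕ → ℝ) → L2 O := fun n q =>
    (trajectory step ((velocitySpace hD hp).orthogonalProjectionOnto q.1) q.2 n :
      velocitySpace hD hp)
  have hsol : ∀ n u ω, D.recon (D.solution κ τ g σ W n u ω) = Φ n (u, increments W τ ω) :=
    fun n u ω => by
      rw [solution, (scheme_eq_lift_trajectory hD hκ hp hG hτ'.le hσ' hh hstep _ u n).1, recon_lift]
  have hproj : Continuous (velocitySpace hD hp).orthogonalProjectionOnto :=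
    ContinuousLinearMap.continuous _
  have hΦ : ∀ n, Continuous (Φ n) := fun n =>
    continuous_subtype_val.comp ((continuous_trajectory
      (continuous_of_crankNicolson hmono hself hstep) n).comp
        ((hproj.comp continuous_fst).prodMk continuous_snd))
  have hinc := aemeasurable_increments hW τ
  have hprob := Measure.isProbabilityMeasure_map hinc
  have hinv : ∀ m : Measure (L2 O), IsInvariant (D.semigroup κ τ g σ P W) m → ∀ n ≥ 1,
      ∀ f : L2 O →ᵇ ℝ,
        ∫ u, ∫ ζ, f (Φ n (u, ζ)) ∂(P.map (increments W τ)) ∂m = ∫ u, f u ∂m := fun m hm n hn f => by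
    rw [← hm n hn f]
    congr 1
    ext u
    have hf : Continuous fun ζ => f (Φ n (u, ζ)) :=
      f.continuous.comp ((hΦ n).comp (continuous_const.prodMk continuous_id))
    rw [integral_map hinc hf.aestronglyMeasurable]
    simp only [semigroup, hsol]
  -- Finiteness of the exponent provides the separability of `L2 O`.
  have : Fact ((2 : ℝ≥0∞) ≠ ∞) := ⟨ENNReal.ofNat_ne_top⟩
  refine eq_of_invariant_of_synchronous_coupling (P.map (increments W τ)) (gaussianReal 0 τ)
    (fun n => ?_) Φ hΦ (fun u v ζ R hfreq => ?_) μ ν (hinv μ hμ) (hinv ν hν)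
  · rw [AEMeasurable.map_map_of_aemeasurable (measurable_pi_apply n).aemeasurable hinc]
    exact map_increments_apply hW τ n
  · exact tendsto_norm_sub_of_crankNicolson hmono
      (eq_of_drift_sub_eq_zero hD hκ hp hG hτ') hself hstep (fun _ => rfl) (fun _ => rfl) hfreq
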